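/- Let $R$ be a commutative ring with $1$, let $q\in R$ be invertible, let $m\ge 1$ and $r\ge 0$ be integers, and let $\mathbf m=(u_1,\dots,u_m)\in R^m$. Let $H=\mathcal H_{\mathbf m}(r)$ be the cyclotomic Hecke (Ariki--Koike) algebra, that is, the $R$-algebra generated by $T_1,\dots,T_{r-1},L_1,\dots,L_r$ with the defining relations $(T_i+1)(T_i-q)=0$; $T_iT_{i+1}T_i=T_{i+1}T_iT_{i+1}$; $T_iT_j=T_jT_i$ if $|i-j|>1$; $L_iL_j=L_jL_i$; $(L_1-u_1)\cdots(L_1-u_m)=0$; $T_iL_iT_i=qL_{i+1}$; $L_jT_i=T_iL_j$ if $j\ne i,i+1$. For $w\in\mathfrak S_r$ put $T_w=T_{i_1}\cdots T_{i_l}$, where $w=s_{i_1}\cdots s_{i_l}$ is a reduced expression in the basic transpositions $s_i=(i,i+1)$. For $n\ge 1$ let $\Lambda(n,r)$ be the set of $\lambda\in\mathbb N^n$ with $\lambda_1+\cdots+\lambda_n=r$, and for $\lambda\in\Lambda(n,r)$ let $x_\lambda=\sum_{w\in\mathfrak S_\lambda}T_w$, where $\mathfrak S_\lambda\le\mathfrak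 S_r$ is the standard Young subgroup. Write $x_{(r)}=\sum_{w\in\mathfrak S_r}T_w$, which is $x_\lambda$ for $\lambda=(r,0,\dots,0)$. Let $\mathcal S_{\mathbf m}(n,r)=\operatorname{End}_{H}\big(\bigoplus_{\lambda\in\Lambda(n,r)}x_\lambda H\big)$ (endomorphisms of right $H$-modules), and let $\mathfrak l_{(r)}\in\mathcal S_{\mathbf m}(n,r)$ be the idempotent that projects onto the summand $x_{(r)}H$ indexed by $(r,0,\dots,0)$. Let $\sigma_i=\sum_{1\le j_1<\cdots<j_i\le r}L_{j_1}\cdots L_{j_i}$ for $1\le i\le r$, let $\sigma^{\mathbf a}=\sigma_1^{a_1}\cdots\sigma_r^{a_r}$ for $\mathbf a\in\mathbb N^r$, and let $\Lambda(r,<m)=\{\mathbf a\in\mathbb N^r : a_1+\cdots+a_r\le m-1\}$. Then: (1) for every $\mathbf a\in\Lambda(r,<m)$ one has $x_{(r)}\sigma^{\mathbf a}=\sigma^{\mathbf a}x_{(r)}$, and the $R$-module $x_{(r)}H\cap Hx_{(r)}$ is free with basis the family $(x_{(r)}\sigma^{\mathbf a})_{\mathbf a\in\Lambda(r,<m)}$;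 (2) the $R$-algebras $\operatorname{End}_H(x_{(r)}H)$ and $\mathcal S_{\mathbf m}(1,r)$ are commutative, and they are isomorphic; (3) for every $n\ge 1$ the centraliser algebra $\mathfrak l_{(r)}\mathcal S_{\mathbf m}(n,r)\mathfrak l_{(r)}$ is a commutative $R$-algebra, isomorphic to $\mathcal S_{\mathbf m}(1,r)$. -/

import Mathlib

open scoped DirectSum

namespace SlimSchur

/-! ### The symmetric group: simple transpositions and reduced words -/

/-- The letter `i` of `{0, …, r-1}`, for `i < r - 1`. -/
def lo {r : ℕ} (i : Fin (r - 1)) : Fin r := ⟨i, by omega⟩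

/-- The letter `i + 1` of `{0, …, r-1}`, for `i < r - 1`. -/
def hi {r : ℕ} (i : Fin (r - 1)) : Fin r := ⟨i + 1, by omega⟩

/-- The basic transposition `s_i = (i, i + 1)`. -/
def simpleRefl {r : ℕ} (i : Fin (r - 1)) : Equiv.Perm (Fin r) := Equiv.swap (lo i) (hi i)

theorem exists_word {r : ℕ} (w : Equiv.Perm (Fin r)) :
    ∃ l : List (Fin (r - 1)), (l.map simpleRefl).prod = w := by
  cases r with
  | zero => exact ⟨[], Subsingleton.elim _ _⟩
  | succ n =>
    have hw : w ∈ Submonoid.closure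
        (Set.range fun i : Fin n ↦ Equiv.swap i.castSucc i.succ) := by
      rw [Equiv.Perm.mclosure_swap_castSucc_succ]; trivial
    induction hw using Submonoid.closure_induction with
    | mem x hx =>
      obtain ⟨i, rfl⟩ := hx
      exact ⟨[i], by simp [simpleRefl]; rfl⟩
    | one => exact ⟨[], rfl⟩
    | mul x y _ _ hx hy =>
      obtain ⟨l, rfl⟩ := hx
      obtain ⟨l', rfl⟩ := hy
      exact ⟨l ++ l', by simp⟩

/-- `l` is a reduced word (a word of minimal length) for `w` in the basic transpositions. -/
def IsReducedWord {r : ℕ} (l : List (Fin (r - 1))) (w : Equiv.Perm (Fin r)) : Prop :=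
  (l.map simpleRefl).prod = w ∧
    ∀ l' : List (Fin (r - 1)), (l'.map simpleRefl).prod = w → l.length ≤ l'.length

theorem exists_reducedWord {r : ℕ} (w : Equiv.Perm (Fin r)) :
    ∃ l : List (Fin (r - 1)), IsReducedWord l w := by
  classical
  have h : ∃ k, ∃ l : List (Fin (r - 1)), (l.map simpleRefl).prod = w ∧ l.length = k := by
    obtain ⟨l, hl⟩ := exists_word w
    exact ⟨_, l, hl, rfl⟩
  obtain ⟨l, hl, hk⟩ := Nat.find_spec h
  exact ⟨l, hl, fun l' hl' ↦ hk ▸ Nat.find_min' h ⟨l', hl', rfl⟩⟩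

/-- A chosen reduced word for `w`. -/
noncomputable def reducedWord {r : ℕ} (w : Equiv.Perm (Fin r)) : List (Fin (r - 1)) :=
  (exists_reducedWord w).choose

/-! ### The cyclotomic Hecke algebra (Ariki--Koike algebra) -/

/-- The generators `T_1, …, T_{r-1}` and `L_1, …, L_r`, with indices shifted to start at `0`. -/
inductive Gen (r : ℕ) : Type
  | T (i : Fin (r - 1)) : Gen r
  | L (j : Fin r) : Gen r

section Hecke

variable {R : Type*} [CommRing R]

/-- The generator `T_i` in the free algebra. -/
def freeT (R : Type*) [CommRing R] {r : ℕ} (i : Fin (r - 1)) : FreeAlgebra R (Gen r) :=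
  FreeAlgebra.ι R (Gen.T i)

/-- The generator `L_j` in the free algebra. -/
def freeL (R : Type*) [CommRing R] {r : ℕ} (j : Fin r) : FreeAlgebra R (Gen r) :=
  FreeAlgebra.ι R (Gen.L j)

/-- The defining relations of the cyclotomic Hecke algebra with parameters `q` and
`u = (u_1, …, u_m)`. -/
inductive HeckeRel (q : R) {m : ℕ} (u : Fin m → R) (r : ℕ) :
    FreeAlgebra R (Gen r) → FreeAlgebra R (Gen r) → Prop
  | quadratic (i : Fin (r - 1)) :
      HeckeRel q u r ((freeT R i + 1) * (freeT R i - algebraMap R _ q)) 0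
  | braid (i j : Fin (r - 1)) (h : (j : ℕ) = i + 1) :
      HeckeRel q u r (freeT R i * freeT R j * freeT R i) (freeT R j * freeT R i * freeT R j)
  | commTT (i j : Fin (r - 1)) (h : (i : ℕ) + 1 < j) :
      HeckeRel q u r (freeT R i * freeT R j) (freeT R j * freeT R i)
  | commLL (i j : Fin r) :
      HeckeRel q u r (freeL R i * freeL R j) (freeL R j * freeL R i)
  | cyclotomic (j : Fin r) (h : (j : ℕ) = 0) :
      HeckeRel q u r (List.ofFn fun k ↦ freeL R j - algebraMap R _ (u k)).prod 0
  | TLT (i : Fin (r - 1)) :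
      HeckeRel q u r (freeT R i * freeL R (lo i) * freeT R i)
        (algebraMap R _ q * freeL R (hi i))
  | commLT (i : Fin (r - 1)) (j : Fin r) (h : j ≠ lo i) (h' : j ≠ hi i) :
      HeckeRel q u r (freeL R j * freeT R i) (freeT R i * freeL R j)

/-- The cyclotomic Hecke algebra `H_m(r)` over `R`. -/
def Hecke (q : R) {m : ℕ} (u : Fin m → R) (r : ℕ) : Type _ := RingQuot (HeckeRel q u r)

instance (q : R) {m : ℕ} (u : Fin m → R) (r : ℕ) : Ring (Hecke q u r) :=
  inferInstanceAs (Ring (RingQuot (HeckeRel q u r)))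

instance (q : R) {m : ℕ} (u : Fin m → R) (r : ℕ) : Algebra R (Hecke q u r) :=
  inferInstanceAs (Algebra R (RingQuot (HeckeRel q u r)))

variable (q : R) {m : ℕ} (u : Fin m → R) {r : ℕ}

/-- The quotient map from the free algebra. -/
noncomputable def Hecke.mk : FreeAlgebra R (Gen r) →ₐ[R] Hecke q u r :=
  RingQuot.mkAlgHom R (HeckeRel q u r)

/-- The generator `T_i` of the Hecke algebra. -/
noncomputable def T (i : Fin (r - 1)) : Hecke q u r := Hecke.mk q u (freeT R i)

/-- The generator `L_j` of the Hecke algebra. -/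
noncomputable def L (j : Fin r) : Hecke q u r := Hecke.mk q u (freeL R j)

/-- `T_w = T_{i_1} ⋯ T_{i_l}` for a reduced expression `w = s_{i_1} ⋯ s_{i_l}`. -/
noncomputable def Tw (w : Equiv.Perm (Fin r)) : Hecke q u r := ((reducedWord w).map (T q u)).prod

/-! ### Compositions, Young subgroups and the elements `x_λ` -/

/-- `Λ(n, r)`: compositions of `r` into `n` (possibly zero) parts. -/
abbrev Comp (n r : ℕ) : Type := {lam : Fin n → ℕ // ∑ i, lam i = r}

/-- The composition `(r, 0, …, 0)` of `r` into `n ≥ 1` parts. -/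
def Comp.row (n r : ℕ) [NeZero n] : Comp n r := ⟨Pi.single 0 r, by simp⟩

/-- The letter `i` lies in the `k`-th block
`{λ_1 + ⋯ + λ_{k-1} + 1, …, λ_1 + ⋯ + λ_k}` of consecutive letters (letters start at `0` here). -/
def InBlock {n r : ℕ} (lam : Comp n r) (k : Fin n) (i : Fin r) : Prop :=
  ∑ j ∈ Finset.Iio k, lam.1 j ≤ i ∧ (i : ℕ) < ∑ j ∈ Finset.Iic k, lam.1 j

/-- The standard Young subgroup `S_λ`, the permutations that map every block to itself. -/
def youngSubgroup {n r : ℕ} (lam : Comp n r) : Subgroup (Equiv.Perm (Fin r)) where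
  carrier := {w | ∀ k i, InBlock lam k (w i) ↔ InBlock lam k i}
  mul_mem' := fun ha hb k i ↦ (ha k _).trans (hb k i)
  one_mem' := fun _ _ ↦ Iff.rfl
  inv_mem' := fun {w} hw k i ↦ by simpa using (hw k (w⁻¹ i)).symm

open Classical in
/-- `x_λ`, the sum of all `T_w` with `w` in `S_λ`. -/
noncomputable def xComp {n : ℕ} (lam : Comp n r) : Hecke q u r :=
  ∑ w ∈ Finset.univ.filter (· ∈ youngSubgroup lam), Tw q u w

/-- `x_(r)`, the sum of all `T_w` with `w` in the symmetric group. -/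
noncomputable def xRow (r : ℕ) : Hecke q u r := ∑ w : Equiv.Perm (Fin r), Tw q u w

/-- The right ideal `x H`, as a right `H`-module. -/
def rightIdeal {q : R} {u : Fin m → R} (x : Hecke q u r) :
    Submodule (Hecke q u r)ᵐᵒᵖ (Hecke q u r) := Submodule.span _ {x}

/-- The left ideal `H x`. -/
def leftIdeal {q : R} {u : Fin m → R} (x : Hecke q u r) :
    Submodule (Hecke q u r) (Hecke q u r) := Submodule.span _ {x}

/-- The `R`-module `x_(r) H ∩ H x_(r)`. -/
noncomputable def rowIntersection (r : ℕ) : Submodule R (Hecke q u r) :=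
  (rightIdeal (xRow q u r)).restrictScalars R ⊓ (leftIdeal (xRow q u r)).restrictScalars R

/-! ### Symmetric polynomials in the Jucys--Murphy elements -/

/-- `σ_k(L_1, …, L_r)`, the sum of `L_{j_1} ⋯ L_{j_k}` over all `j_1 < ⋯ < j_k`. -/
noncomputable def sigma (r k : ℕ) : Hecke q u r :=
  ∑ S ∈ Finset.powersetCard k (Finset.univ : Finset (Fin r)), (S.sort.map (L q u)).prod

/-- `σ^a = σ_1^{a_1} ⋯ σ_r^{a_r}`. -/
noncomputable def sigmaPow (a : Fin r → ℕ) : Hecke q u r :=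
  (List.ofFn fun i : Fin r ↦ sigma q u r (i + 1) ^ a i).prod

/-- `Λ(r, < m)`: tuples in `ℕ ^ r` whose sum is less than `m`. -/
abbrev CompLT (r m : ℕ) : Type := {a : Fin r → ℕ // ∑ i, a i < m}

/-! ### The slim cyclotomic `q`-Schur algebra and its centraliser algebras -/

/-- The right `H`-module `⨁_{λ ∈ Λ(n, r)} x_λ H`. -/
abbrev TensorModule (n r : ℕ) : Type _ := ⨁ lam : Comp n r, rightIdeal (xComp q u lam)

/-- The slim cyclotomic `q`-Schur algebra `S_m(n, r)`. -/
abbrev Schur (n r : ℕ) : Type _ := Module.End (Hecke q u r)ᵐᵒᵖ (TensorModule q u n r)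

/-- The idempotent `l_μ` of `S_m(n, r)`: project to the summand `x_μ H`, then include it. -/
noncomputable def idem {n : ℕ} (mu : Comp n r) : Schur q u n r :=
  (DirectSum.lof (Hecke q u r)ᵐᵒᵖ (Comp n r) (fun lam ↦ rightIdeal (xComp q u lam)) mu) ∘ₗ
    (DirectSum.component (Hecke q u r)ᵐᵒᵖ (Comp n r) (fun lam ↦ rightIdeal (xComp q u lam)) mu)

theorem idem_isIdempotentElem {n : ℕ} (mu : Comp n r) : IsIdempotentElem (idem q u mu) := by
  ext1 lam
  ext1 x
  simp [idem, DirectSum.component.lof_self]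

/-- The centraliser algebra `l_μ S_m(n, r) l_μ`, with unit `l_μ`. -/
abbrev Centraliser {n : ℕ} (mu : Comp n r) : Type _ := (idem_isIdempotentElem q u mu).Corner

end Hecke

/-- The scalar multiplication of the corner `e A e` of an `R`-algebra `A`, inherited from `A`. -/
instance cornerModule {R A : Type*} [CommSemiring R] [Semiring A] [Algebra R A] {e : A}
    (he : IsIdempotentElem e) : Module R he.Corner where
  smul c x := ⟨c • x.1, by
    have hx := (Subsemigroup.mem_corner_iff he).mp x.2
    exact (Subsemigroup.mem_corner_iff he).mpr
      ⟨by rw [mul_smul_comm, hx.1], by rw [smul_mul_assoc, hx.2]⟩⟩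
  one_smul x := Subtype.ext (one_smul R x.1)
  mul_smul c d x := Subtype.ext (mul_smul c d x.1)
  smul_zero c := Subtype.ext (smul_zero c)
  smul_add c x y := Subtype.ext (smul_add c x.1 y.1)
  add_smul c d x := Subtype.ext (add_smul c d x.1)
  zero_smul x := Subtype.ext (zero_smul R x.1)

/-- The corner `e A e` of an `R`-algebra `A` is an `R`-algebra. -/
instance cornerAlgebra {R A : Type*} [CommSemiring R] [Semiring A] [Algebra R A] {e : A}
    (he : IsIdempotentElem e) : Algebra R he.Corner :=
  Algebra.ofModule
    (fun c x y ↦ Subtype.ext (smul_mul_assoc c x.1 y.1))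
    (fun c x y ↦ Subtype.ext (mul_smul_comm c x.1 y.1))

end SlimSchur

namespace SlimSchur

/-! ### Inversions and reduced words -/

section Inversions

variable {r : ℕ}

/-! Write `x` for `x_(r)`, `s_i` for the exchange of `X_i` and `X_{i+1}`, and `D_i f = X_{i+1} (f -
s_i f) / (X_{i+1} - X_i)` (`dem`). Since `x T_i = q x` (`xRow_mul_T`), the Bernstein relation
`ev_mul_T` gives `x f(L) T_i = x (q s_i f + (q - 1) D_i f)(L)`. So right multiplication on `xH` can
be computed on polynomials, and every element of `xH` is `x f(L)` with all exponents of `f` less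
than `m` (`exists_trunc_of_xRow_mul`).

Such an `f` is unique (`eq_zero_of_xRow_mul_ev`), which is the main work. A representation of `H` is
built on `E ⊗ trunc`, where `E` is the regular representation of the Hecke algebra of the symmetric
group, `T_i` acts by a Bernstein formula and `L_1` by multiplication by `X_1` reduced modulo the
cyclotomic polynomial in `X_1`. The other `L_j` are then forced, and their commutation comes down to
the reflection equation `L_1 T_1 L_1 T_1 = T_1 L_1 T_1 L_1` (`truncL_reflection`). Matsumoto's
theorem is what makes `T_w T_i = T_{w s_i}` available on ascents.

Given uniqueness, `y = x f(L)` satisfies `y T_i = q y` only if `(X_{i+1} - q X_i) (f - s_i f) /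
(X_{i+1} - X_i) = 0`. The first factor is regular, so `f` is symmetric (`polySwap_eq_of_eigen`).
Elements of `Hx` satisfy `y T_i = q y`, and `f(L)` commutes with `x` for symmetric `f`; hence `xH ∩
Hx` consists of the `x f(L)` with `f` symmetric and exponents less than `m`. The leading monomial of
a product of elementary symmetric polynomials has the sum of the `a_i` as its first exponent, so
these `f` are the combinations of the `σ^a` with that sum less than `m`.

An endomorphism of `xH` sends `x` to some `y` with `y T_i = q y`, so it is left multiplication by a
polynomial in the commuting `L_j`; this gives commutativity. The corner of the Schur algebra at a
summand is the endomorphism ring of the summand, and for `n = 1` there is only one summand. -/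

theorem lo_lt_hi (i : Fin (r - 1)) : lo i < hi i := by simp [lo, hi, Fin.lt_def]

theorem lo_ne_hi (i : Fin (r - 1)) : lo i ≠ hi i := (lo_lt_hi i).ne

@[simp] theorem simpleRefl_lo (i : Fin (r - 1)) : simpleRefl i (lo i) = hi i := by
  simp [simpleRefl]

@[simp] theorem simpleRefl_hi (i : Fin (r - 1)) : simpleRefl i (hi i) = lo i := by
  simp [simpleRefl]

theorem simpleRefl_of_ne {i : Fin (r - 1)} {a : Fin r} (h : a ≠ lo i) (h' : a ≠ hi i) :
    simpleRefl i a = a := Equiv.swap_apply_of_ne_of_ne h h'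

@[simp] theorem simpleRefl_mul_self (i : Fin (r - 1)) : simpleRefl i * simpleRefl i = 1 := by
  simp [simpleRefl]

@[simp] theorem simpleRefl_apply_apply (i : Fin (r - 1)) (a : Fin r) :
    simpleRefl i (simpleRefl i a) = a := by
  rw [← Equiv.Perm.mul_apply, simpleRefl_mul_self, Equiv.Perm.one_apply]

@[simp] theorem mul_simpleRefl_mul_simpleRefl (w : Equiv.Perm (Fin r)) (i : Fin (r - 1)) :
    w * simpleRefl i * simpleRefl i = w := by
  rw [mul_assoc, simpleRefl_mul_self, mul_one]

theorem lo_eq_hi {i j : Fin (r - 1)} (h : (j : ℕ) = i + 1) : lo j = hi i := by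
  simp [lo, hi, h]

theorem simpleRefl_hi_of_succ {i j : Fin (r - 1)} (h : (j : ℕ) = i + 1) :
    simpleRefl i (hi j) = hi j :=
  simpleRefl_of_ne (by simp [lo, hi, Fin.ext_iff]; omega) (by simp [hi, Fin.ext_iff]; omega)

theorem simpleRefl_lo_of_succ {i j : Fin (r - 1)} (h : (j : ℕ) = i + 1) :
    simpleRefl j (lo i) = lo i :=
  simpleRefl_of_ne (by simp [lo, Fin.ext_iff]; omega) (by simp [lo, hi, Fin.ext_iff]; omega)

theorem simpleRefl_mul_simpleRefl (i j : Fin (r - 1)) :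
    simpleRefl i * simpleRefl j =
      Equiv.swap (simpleRefl i (lo j)) (simpleRefl i (hi j)) * simpleRefl i :=
  Equiv.mul_swap_eq_swap_mul _ _ _

theorem simpleRefl_comm {i j : Fin (r - 1)} (h : (i : ℕ) + 1 < j) :
    simpleRefl i * simpleRefl j = simpleRefl j * simpleRefl i := by
  rw [simpleRefl_mul_simpleRefl, simpleRefl_of_ne, simpleRefl_of_ne, ← simpleRefl]
  all_goals simp only [lo, hi, ne_eq, Fin.mk.injEq]; omega

theorem simpleRefl_braid {i j : Fin (r - 1)} (h : (j : ℕ) = i + 1) :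
    simpleRefl i * simpleRefl j * simpleRefl i = simpleRefl j * simpleRefl i * simpleRefl j := by
  rw [simpleRefl_mul_simpleRefl i, simpleRefl_mul_simpleRefl j i, mul_simpleRefl_mul_simpleRefl,
    mul_simpleRefl_mul_simpleRefl, lo_eq_hi h, simpleRefl_hi, simpleRefl_hi_of_succ h, ← lo_eq_hi h,
    simpleRefl_lo, simpleRefl_lo_of_succ h]

/-- The pair `(lo i, hi i)` is the only one whose order is reversed, so right multiplication by
`s_i` changes the number of inversions by exactly one. -/
theorem simpleRefl_lt {i : Fin (r - 1)} {a b : Fin r} (hab : a < b)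
    (h : ¬(a = lo i ∧ b = hi i)) : simpleRefl i a < simpleRefl i b := by
  simp only [simpleRefl, Equiv.swap_apply_def, lo, hi, Fin.ext_iff, Fin.lt_def] at *
  split_ifs <;> simp_all <;> omega

/-- The set of inversions of a permutation. -/
def invSet (w : Equiv.Perm (Fin r)) : Finset (Fin r × Fin r) :=
  Finset.univ.filter fun p ↦ p.1 < p.2 ∧ w p.2 < w p.1

theorem mem_invSet {w : Equiv.Perm (Fin r)} {p : Fin r × Fin r} :
    p ∈ invSet w ↔ p.1 < p.2 ∧ w p.2 < w p.1 := by
  simp [invSet]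

/-- The number of inversions of a permutation. -/
def inv (w : Equiv.Perm (Fin r)) : ℕ := (invSet w).card

theorem inv_mul_simpleRefl_of_lt {w : Equiv.Perm (Fin r)} {i : Fin (r - 1)}
    (h : w (lo i) < w (hi i)) : inv (w * simpleRefl i) = inv w + 1 := by
  have hset : invSet (w * simpleRefl i) = insert (lo i, hi i)
      ((invSet w).map (Equiv.prodCongr (simpleRefl i) (simpleRefl i)).toEmbedding) := by
    ext ⟨a, b⟩
    simp only [Finset.mem_insert, Finset.mem_map_equiv, mem_invSet, Equiv.Perm.mul_apply, Prod.mk.injEq]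
    have hs : (Equiv.prodCongr (simpleRefl i) (simpleRefl i)).symm (a, b) =
        (simpleRefl i a, simpleRefl i b) := by
      rw [Equiv.symm_apply_eq]; simp
    rw [hs]
    by_cases hab : a = lo i ∧ b = hi i
    · simp only [hab.1, hab.2, and_self, true_or, iff_true]
      exact ⟨lo_lt_hi i, by simpa using h⟩
    · simp only [hab, false_or]
      refine and_congr_left fun h2 ↦ ⟨fun h1 ↦ simpleRefl_lt h1 hab, fun h1 ↦ ?_⟩
      by_cases h3 : simpleRefl i a = lo i ∧ simpleRefl i b = hi i
      · rw [h3.1, h3.2] at h2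
        exact absurd h2 h.not_gt
      · simpa using simpleRefl_lt h1 h3
  rw [inv, hset, Finset.card_insert_of_notMem, Finset.card_map, inv]
  have hs : (Equiv.prodCongr (simpleRefl i) (simpleRefl i)).symm (lo i, hi i) = (hi i, lo i) := by
    rw [Equiv.symm_apply_eq]; simp
  rw [Finset.mem_map_equiv, hs, mem_invSet]
  simp [(lo_lt_hi i).not_gt]

theorem inv_mul_simpleRefl_of_gt {w : Equiv.Perm (Fin r)} {i : Fin (r - 1)}
    (h : w (hi i) < w (lo i)) : inv (w * simpleRefl i) + 1 = inv w := by
  have := inv_mul_simpleRefl_of_lt (w := w * simpleRefl i) (i := i) (by simpa using h)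
  simpa using this.symm

theorem lt_or_gt_lo_hi (w : Equiv.Perm (Fin r)) (i : Fin (r - 1)) :
    w (lo i) < w (hi i) ∨ w (hi i) < w (lo i) :=
  lt_or_gt_of_ne (w.injective.ne (lo_ne_hi i))

theorem inv_mul_simpleRefl_le (w : Equiv.Perm (Fin r)) (i : Fin (r - 1)) :
    inv (w * simpleRefl i) ≤ inv w + 1 := by
  rcases lt_or_gt_lo_hi w i with h | h
  · exact (inv_mul_simpleRefl_of_lt h).le
  · have := inv_mul_simpleRefl_of_gt h; omega

@[simp] theorem inv_one : inv (1 : Equiv.Perm (Fin r)) = 0 := by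
  rw [inv, Finset.card_eq_zero, invSet, Finset.filter_eq_empty_iff]
  rintro ⟨a, b⟩ - ⟨h, h'⟩
  exact absurd h h'.not_gt

theorem inv_prod_le (l : List (Fin (r - 1))) : inv (l.map simpleRefl).prod ≤ l.length := by
  induction l using List.reverseRecOn with
  | nil => simp
  | append_singleton l i ih =>
    have := inv_mul_simpleRefl_le (l.map simpleRefl).prod i
    simp only [List.map_append, List.map_cons, List.map_nil, List.prod_append, List.prod_singleton,
      List.length_append, List.length_singleton]
    omega

/-- Without descents `w` would be an order automorphism of a finite chain, hence trivial. Removing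
descents one by one yields a word of length `inv w`. -/
theorem exists_descent {w : Equiv.Perm (Fin r)} (h : w ≠ 1) :
    ∃ i : Fin (r - 1), w (hi i) < w (lo i) := by
  by_contra! hw
  apply h
  have hmono : StrictMono w := by
    cases r with
    | zero => exact fun a ↦ a.elim0
    | succ n =>
      rw [Fin.strictMono_iff_lt_succ]
      intro i
      exact (lt_or_gt_lo_hi w i).resolve_right (hw i).not_gt
  have h2 : (hmono.orderIsoOfSurjective _ w.surjective) = OrderIso.refl _ := Subsingleton.elim _ _
  ext a
  have := congrArg (fun e ↦ e a) h2
  simpa using congrArg Fin.val this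

theorem exists_word_length_eq_inv (w : Equiv.Perm (Fin r)) :
    ∃ l : List (Fin (r - 1)), (l.map simpleRefl).prod = w ∧ l.length = inv w := by
  induction hn : inv w generalizing w with
  | zero =>
    by_cases h : w = 1
    · exact ⟨[], by simp [h]⟩
    · obtain ⟨i, hi'⟩ := exists_descent h
      have := inv_mul_simpleRefl_of_gt hi'
      omega
  | succ n ih =>
    by_cases h : w = 1
    · subst h; simp at hn
    · obtain ⟨i, hi'⟩ := exists_descent h
      have := inv_mul_simpleRefl_of_gt hi'
      obtain ⟨l, hl, hl'⟩ := ih (w * simpleRefl i) (by omega)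
      exact ⟨l ++ [i], by simp [hl], by simp [hl']⟩

theorem isReducedWord_iff {l : List (Fin (r - 1))} {w : Equiv.Perm (Fin r)} :
    IsReducedWord l w ↔ (l.map simpleRefl).prod = w ∧ l.length = inv w := by
  refine and_congr_right fun h ↦ ⟨fun h' ↦ ?_, fun h' l' hl' ↦ ?_⟩
  · obtain ⟨l', hl', hl⟩ := exists_word_length_eq_inv w
    refine le_antisymm (hl ▸ h' l' hl') (h ▸ inv_prod_le l)
  · rw [h', ← hl']
    exact inv_prod_le l'

theorem reducedWord_prod (w : Equiv.Perm (Fin r)) : ((reducedWord w).map simpleRefl).prod = w :=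
  (exists_reducedWord w).choose_spec.1

theorem reducedWord_length (w : Equiv.Perm (Fin r)) : (reducedWord w).length = inv w :=
  (isReducedWord_iff.mp (exists_reducedWord w).choose_spec).2

theorem inv_mul_simpleRefl_lt {v : Equiv.Perm (Fin r)} {i : Fin (r - 1)} {n : ℕ}
    (h : inv v = n) (h' : inv (v * simpleRefl i) = n + 1) : v (lo i) < v (hi i) := by
  refine (lt_or_gt_lo_hi v i).resolve_right fun h2 ↦ ?_
  have := inv_mul_simpleRefl_of_gt h2
  omega

/-- The inductive step of Matsumoto's theorem, for reduced words of `v s_i = v' s_j`. -/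
theorem prod_mul_eq_of_mul_simpleRefl_eq {M : Type*} [Monoid M] (τ : Fin (r - 1) → M)
    (braid : ∀ i j : Fin (r - 1), (j : ℕ) = i + 1 → τ i * τ j * τ i = τ j * τ i * τ j)
    (comm : ∀ i j : Fin (r - 1), (i : ℕ) + 1 < j → τ i * τ j = τ j * τ i)
    {v v' : Equiv.Perm (Fin r)} {i j : Fin (r - 1)} {n : ℕ} {t t' : M}
    (h : v * simpleRefl i = v' * simpleRefl j) (hv : inv v = n) (hv' : inv v' = n)
    (hn : inv (v * simpleRefl i) = n + 1) (hij : (i : ℕ) < j)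
    (ht : ∀ p : List (Fin (r - 1)), (p.map simpleRefl).prod = v → p.length = n →
      t = (p.map τ).prod)
    (ht' : ∀ p : List (Fin (r - 1)), (p.map simpleRefl).prod = v' → p.length = n →
      t' = (p.map τ).prod) : t * τ i = t' * τ j := by
  have hi1 := inv_mul_simpleRefl_lt hv hn
  have hj1 := inv_mul_simpleRefl_lt hv' (h ▸ hn)
  have hvv : v = v' * simpleRefl j * simpleRefl i := by rw [← h, mul_simpleRefl_mul_simpleRefl]
  -- The permutation `v s_i = v' s_j` has descents at `i` and at `j`, so the longest element of the
  -- subgroup generated by `s_i` and `s_j` splits off on the right: `s_i s_j` if they commute, `s_i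
  -- s_j s_i` if they are neighbours. Over the common prefix `p` the two words differ by a single
  -- relation.
  rcases Nat.lt_or_ge (i + 1) j with hij2 | hij2
  · have hc := simpleRefl_comm hij2
    have hvj : v * simpleRefl j = v' * simpleRefl i := by
      rw [hvv, mul_assoc, mul_assoc, hc, ← mul_assoc, ← mul_assoc, mul_simpleRefl_mul_simpleRefl]
    have hd : v (hi j) < v (lo j) := by
      have e1 : v (hi j) = v' (lo j) := by
        rw [hvv, Equiv.Perm.mul_apply, Equiv.Perm.mul_apply, simpleRefl_of_ne (i := i),
          simpleRefl_hi]
        all_goals simp only [lo, hi, ne_eq, Fin.mk.injEq]; omega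
      have e2 : v (lo j) = v' (hi j) := by
        rw [hvv, Equiv.Perm.mul_apply, Equiv.Perm.mul_apply, simpleRefl_of_ne (i := i),
          simpleRefl_lo]
        all_goals simp only [lo, hi, ne_eq, Fin.mk.injEq]; omega
      rwa [e1, e2]
    have hlen := inv_mul_simpleRefl_of_gt hd
    obtain ⟨p, hp, hpl⟩ := exists_word_length_eq_inv (v * simpleRefl j)
    rw [ht (p ++ [j]) (by simp [hp]) (by simp [hpl]; omega),
      ht' (p ++ [i]) (by simp [hp, hvj]) (by simp [hpl]; omega)]
    simp only [List.map_append, List.map_cons, List.map_nil, List.prod_append, List.prod_singleton]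
    rw [mul_assoc, mul_assoc, comm i j hij2]
  · have hij3 : (j : ℕ) = i + 1 := by omega
    have hb := simpleRefl_braid hij3
    have hvji : v * simpleRefl j * simpleRefl i = v' * simpleRefl i * simpleRefl j := by
      calc v * simpleRefl j * simpleRefl i
          = v' * simpleRefl j * (simpleRefl i * simpleRefl j * simpleRefl i) := by
            rw [hvv]; simp only [mul_assoc]
        _ = v' * simpleRefl i * simpleRefl j := by
            rw [hb]; simp only [← mul_assoc, mul_simpleRefl_mul_simpleRefl]
    have e1 : v (lo i) = v' (hi j) := by simp [hvv, ← lo_eq_hi hij3]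
    have e2 : v (hi i) = v' (lo i) := by simp [hvv, simpleRefl_lo_of_succ hij3]
    have e3 : v (hi j) = v' (lo j) := by simp [hvv, simpleRefl_hi_of_succ hij3]
    rw [e1, e2] at hi1
    have hd : v (hi j) < v (lo j) := by
      rw [e3, lo_eq_hi hij3, e2, ← lo_eq_hi hij3]
      exact hj1.trans hi1
    have hd2 : (v * simpleRefl j) (hi i) < (v * simpleRefl j) (lo i) := by
      rw [← lo_eq_hi hij3, Equiv.Perm.mul_apply, simpleRefl_lo, Equiv.Perm.mul_apply,
        simpleRefl_lo_of_succ hij3, e1, e3]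
      exact hj1
    have hlen := inv_mul_simpleRefl_of_gt hd
    have hlen2 := inv_mul_simpleRefl_of_gt hd2
    obtain ⟨p, hp, hpl⟩ := exists_word_length_eq_inv (v * simpleRefl j * simpleRefl i)
    rw [ht (p ++ [i, j]) (by simp [hp, ← mul_assoc]) (by simp [hpl]; omega),
      ht' (p ++ [j, i]) (by simp [hp, hvji, ← mul_assoc]) (by simp [hpl]; omega)]
    simp only [List.map_append, List.map_cons, List.map_nil, List.prod_append, List.prod_cons,
      List.prod_nil, mul_one]
    rw [mul_assoc, mul_assoc, ← mul_assoc (τ i), braid i j hij3]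
    simp only [mul_assoc]

/-- **Matsumoto's theorem** for the symmetric group: the product of elements subject to the braid
relations along a reduced word depends only on the permutation. -/
theorem prod_map_eq_of_reduced {M : Type*} [Monoid M] (τ : Fin (r - 1) → M)
    (braid : ∀ i j : Fin (r - 1), (j : ℕ) = i + 1 → τ i * τ j * τ i = τ j * τ i * τ j)
    (comm : ∀ i j : Fin (r - 1), (i : ℕ) + 1 < j → τ i * τ j = τ j * τ i)
    {l l' : List (Fin (r - 1))} (h : (l.map simpleRefl).prod = (l'.map simpleRefl).prod)
    (hl : l.length = inv (l.map simpleRefl).prod) (hl' : l'.length = inv (l'.map simpleRefl).prod) :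
    (l.map τ).prod = (l'.map τ).prod := by
  induction hn : l.length generalizing l l' with
  | zero =>
    have h1 : l = [] := List.length_eq_zero_iff.mp hn
    have h2 : l' = [] := List.length_eq_zero_iff.mp (by rw [hl', ← h, ← hl, hn])
    rw [h1, h2]
  | succ n ih =>
    have hlen : l'.length = n + 1 := by rw [hl', ← h, ← hl, hn]
    obtain rfl | ⟨k, i, rfl⟩ := List.eq_nil_or_concat' l
    · simp at hn
    obtain rfl | ⟨k', j, rfl⟩ := List.eq_nil_or_concat' l'
    · simp at hlen
    simp only [List.map_append, List.map_cons, List.map_nil, List.prod_append, List.prod_singleton,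
      List.length_append, List.length_singleton, add_left_inj] at h hl hl' hn hlen ⊢
    set v := (k.map simpleRefl).prod with hv
    set v' := (k'.map simpleRefl).prod with hv'
    have hvn : inv v = n := by
      have h1 : inv v ≤ _ := inv_prod_le k
      have h2 := inv_mul_simpleRefl_le v i
      omega
    have hvn' : inv v' = n := by
      have h1 : inv v' ≤ _ := inv_prod_le k'
      have h2 := inv_mul_simpleRefl_le v' j
      omega
    -- a reduced word for `v` may be replaced by any other
    have hk : ∀ p : List (Fin (r - 1)), (p.map simpleRefl).prod = v → p.length = n →
        (k.map τ).prod = (p.map τ).prod := fun p hp hpn ↦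
      ih (hp ▸ hv.symm) (by rw [← hv, hvn, hn]) (by rw [hp, hvn, hpn]) hn
    have hk' : ∀ p : List (Fin (r - 1)), (p.map simpleRefl).prod = v' → p.length = n →
        (k'.map τ).prod = (p.map τ).prod := fun p hp hpn ↦
      ih (hp ▸ hv'.symm) (by rw [← hv', hvn', hlen]) (by rw [hp, hvn', hpn]) hlen
    rcases lt_trichotomy (i : ℕ) j with hij | hij | hij
    · exact prod_mul_eq_of_mul_simpleRefl_eq τ braid comm h hvn hvn' (by omega) hij hk hk'
    · obtain rfl : i = j := Fin.ext hij
      rw [hk k' (by rw [← hv']; exact (mul_right_cancel h).symm) hlen]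
    · exact (prod_mul_eq_of_mul_simpleRefl_eq τ braid comm h.symm hvn' hvn (by omega) hij hk' hk).symm

/-- The product along the chosen reduced word, multiplied by a simple generator. -/
theorem prod_reducedWord_mul {M : Type*} [Monoid M] (τ : Fin (r - 1) → M)
    (braid : ∀ i j : Fin (r - 1), (j : ℕ) = i + 1 → τ i * τ j * τ i = τ j * τ i * τ j)
    (comm : ∀ i j : Fin (r - 1), (i : ℕ) + 1 < j → τ i * τ j = τ j * τ i)
    {w : Equiv.Perm (Fin r)} {i : Fin (r - 1)} (h : w (lo i) < w (hi i)) :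
    ((reducedWord w).map τ).prod * τ i = ((reducedWord (w * simpleRefl i)).map τ).prod := by
  have := prod_map_eq_of_reduced τ braid comm (l := reducedWord w ++ [i])
    (l' := reducedWord (w * simpleRefl i)) (by simp [reducedWord_prod])
    (by simp [reducedWord_prod, reducedWord_length, inv_mul_simpleRefl_of_lt h])
    (by rw [reducedWord_prod, reducedWord_length])
  simpa using this

/-- If `g` satisfies the recursion of right multiplication by simple transpositions on ascents,
then acting along a reduced word of `w` sends `g 1` to `g w`. -/
theorem foldl_reducedWord {X : Type*} (g : Equiv.Perm (Fin r) → X) (act : X → Fin (r - 1) → X)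
    (h : ∀ w i, w (lo i) < w (hi i) → act (g w) i = g (w * simpleRefl i))
    (l : List (Fin (r - 1))) (hl : l.length = inv (l.map simpleRefl).prod) :
    l.foldl act (g 1) = g (l.map simpleRefl).prod := by
  induction l using List.reverseRecOn with
  | nil => simp
  | append_singleton l i ih =>
    simp only [List.map_append, List.map_cons, List.map_nil, List.prod_append, List.prod_singleton,
      List.length_append, List.length_singleton, List.foldl_append, List.foldl_cons,
      List.foldl_nil] at hl ⊢
    have h1 := inv_prod_le l
    have h2 := inv_mul_simpleRefl_le (l.map simpleRefl).prod i
    rw [ih (by omega)]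
    exact h _ _ (inv_mul_simpleRefl_lt (n := l.length) (by omega) (by omega))

end Inversions

/-! ### Divided differences -/

section Polynomials

open MvPolynomial

variable {R : Type*} [CommRing R]

/-- The substitution `X_b ↦ X_b + c X_a` is injective and turns the element into the variable `X_b`,
which is regular over any ring. -/
theorem isRegular_X_sub_C_mul_X {σ : Type*} {a b : σ} (h : a ≠ b) (c : R) :
    IsRegular (X b - C c * X a : MvPolynomial σ R) := by
  classical
  let shift (d : R) : MvPolynomial σ R →ₐ[R] MvPolynomial σ R :=
    aeval fun j ↦ if j = b then X b + C d * X a else X j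
  have hinv : (shift (-c)).comp (shift c) = AlgHom.id R _ := by
    ext1 j
    by_cases hj : j = b
    · subst hj; simp [shift, h]
    · simp [shift, hj]
  refine isRegular_iff_mem_nonZeroDivisors.mpr (mem_nonZeroDivisors_iff_right.mpr fun f hf ↦ ?_)
  have h1 : shift c f * X b = 0 := by
    have := congrArg (shift c) hf
    simpa [shift, h] using this
  have h2 : shift c f = 0 := (isRegular_X (R := R) (n := b)).right (by simpa using h1)
  have h3 := congrArg (fun g ↦ g f) hinv
  simpa [h2] using h3.symm

variable {r : ℕ} (R)

/-- The algebra of polynomials in `r` variables. -/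
abbrev Poly (r : ℕ) : Type _ := MvPolynomial (Fin r) R

variable {R}

/-- Exchange of the variables `X_i` and `X_{i+1}`. -/
noncomputable def polySwap (i : Fin (r - 1)) : Poly R r →ₐ[R] Poly R r := rename (simpleRefl i)

theorem polySwap_X (i : Fin (r - 1)) (j : Fin r) :
    polySwap i (X j : Poly R r) = X (simpleRefl i j) := rename_X _ _

@[simp] theorem polySwap_polySwap (i : Fin (r - 1)) (f : Poly R r) :
    polySwap i (polySwap i f) = f := by
  rw [polySwap, rename_rename]
  have : (simpleRefl i : Fin r → Fin r) ∘ simpleRefl i = id := by ext1 a; simp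
  rw [this, rename_id_apply]

theorem isRegular_X_hi_sub_X_lo (i : Fin (r - 1)) : IsRegular (X (hi i) - X (lo i) : Poly R r) := by
  simpa using isRegular_X_sub_C_mul_X (lo_ne_hi i) (1 : R)

theorem X_sub_X_dvd (i : Fin (r - 1)) (f : Poly R r) :
    X (hi i) - X (lo i) ∣ f - polySwap i f := by
  induction f using MvPolynomial.induction_on with
  | C a => simp [polySwap]
  | add f g hf hg =>
    rw [map_add, add_sub_add_comm]
    exact dvd_add hf hg
  | mul_X f j hf =>
    have : f * X j - polySwap i (f * X j) =
        (f - polySwap i f) * X j + polySwap i f * (X j - X (simpleRefl i j)) := by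
      rw [map_mul, polySwap_X]; ring
    rw [this]
    refine dvd_add (hf.mul_right _) (Dvd.dvd.mul_left ?_ _)
    by_cases h1 : j = lo i
    · subst h1
      rw [simpleRefl_lo, ← neg_sub (X (hi i)), dvd_neg]
    · by_cases h2 : j = hi i
      · subst h2
        rw [simpleRefl_hi]
      · rw [simpleRefl_of_ne h1 h2, sub_self]
        exact dvd_zero _

/-- The divided difference `(f - s_i f) / (X_{i+1} - X_i)`. -/
noncomputable def divDiff (i : Fin (r - 1)) : Poly R r →ₗ[R] Poly R r where
  toFun f := (X_sub_X_dvd i f).choose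
  map_add' f g := (isRegular_X_hi_sub_X_lo (R := R) i).left <| by
    have h1 := (X_sub_X_dvd i (f + g)).choose_spec
    have h2 := (X_sub_X_dvd i f).choose_spec
    have h3 := (X_sub_X_dvd i g).choose_spec
    simp only [mul_add]
    rw [← h1, ← h2, ← h3, map_add]
    ring
  map_smul' c f := (isRegular_X_hi_sub_X_lo (R := R) i).left <| by
    have h1 := (X_sub_X_dvd i (c • f)).choose_spec
    have h2 := (X_sub_X_dvd i f).choose_spec
    simp only [RingHom.id_apply, mul_smul_comm]
    rw [← h1, ← h2, map_smul, smul_sub]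

theorem mul_divDiff (i : Fin (r - 1)) (f : Poly R r) :
    (X (hi i) - X (lo i)) * divDiff i f = f - polySwap i f :=
  (X_sub_X_dvd i f).choose_spec.symm

theorem divDiff_eq_of_mul_eq {i : Fin (r - 1)} {f g : Poly R r}
    (h : (X (hi i) - X (lo i)) * g = f - polySwap i f) : divDiff i f = g :=
  (isRegular_X_hi_sub_X_lo (R := R) i).left (by simpa only [mul_divDiff] using h.symm)

theorem divDiff_eq_zero {i : Fin (r - 1)} {f : Poly R r} (h : polySwap i f = f) :
    divDiff i f = 0 := divDiff_eq_of_mul_eq (by rw [h, mul_zero, sub_self])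

theorem divDiff_mul (i : Fin (r - 1)) (f g : Poly R r) :
    divDiff i (f * g) = divDiff i f * g + polySwap i f * divDiff i g :=
  divDiff_eq_of_mul_eq <| by
    rw [mul_add, ← mul_assoc, mul_divDiff, mul_left_comm, mul_divDiff, map_mul]; ring

theorem polySwap_divDiff (i : Fin (r - 1)) (f : Poly R r) :
    polySwap i (divDiff i f) = divDiff i f := by
  refine ((isRegular_X_hi_sub_X_lo (R := R) i).left ?_).symm
  have h := congrArg (polySwap i) (mul_divDiff i f)
  simp only [map_mul, map_sub, polySwap_X, simpleRefl_hi, simpleRefl_lo, polySwap_polySwap] at h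
  simp only [mul_divDiff]
  linear_combination h

theorem divDiff_polySwap (i : Fin (r - 1)) (f : Poly R r) :
    divDiff i (polySwap i f) = - divDiff i f :=
  divDiff_eq_of_mul_eq <| by rw [mul_neg, mul_divDiff, polySwap_polySwap, neg_sub]

/-- The operator `X_{i+1} (f - s_i f) / (X_{i+1} - X_i)`. -/
noncomputable def dem (i : Fin (r - 1)) : Poly R r →ₗ[R] Poly R r :=
  LinearMap.mulLeft R (X (hi i)) ∘ₗ divDiff i

theorem dem_apply (i : Fin (r - 1)) (f : Poly R r) : dem i f = X (hi i) * divDiff i f := rfl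

theorem dem_eq_zero {i : Fin (r - 1)} {f : Poly R r} (h : polySwap i f = f) : dem i f = 0 := by
  rw [dem_apply, divDiff_eq_zero h, mul_zero]

@[simp] theorem dem_one (i : Fin (r - 1)) : dem i (1 : Poly R r) = 0 := dem_eq_zero (map_one _)

theorem dem_mul_of_polySwap_eq {i : Fin (r - 1)} {f : Poly R r} (h : polySwap i f = f)
    (g : Poly R r) : dem i (f * g) = f * dem i g := by
  rw [dem_apply, dem_apply, divDiff_mul, divDiff_eq_zero h, h]; ring

theorem divDiff_X_lo (i : Fin (r - 1)) : divDiff i (X (lo i) : Poly R r) = -1 :=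
  divDiff_eq_of_mul_eq <| by rw [polySwap_X, simpleRefl_lo]; ring

theorem divDiff_X_hi (i : Fin (r - 1)) : divDiff i (X (hi i) : Poly R r) = 1 :=
  divDiff_eq_of_mul_eq <| by rw [polySwap_X, simpleRefl_hi]; ring

theorem dem_X_lo_mul (i : Fin (r - 1)) (f : Poly R r) :
    dem i (X (lo i) * f) = X (hi i) * dem i f - X (hi i) * f := by
  rw [dem_apply, dem_apply, divDiff_mul, divDiff_X_lo, polySwap_X, simpleRefl_lo]; ring

theorem dem_X_hi_mul (i : Fin (r - 1)) (f : Poly R r) :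
    dem i (X (hi i) * f) = X (lo i) * dem i f + X (hi i) * f := by
  rw [dem_apply, dem_apply, divDiff_mul, divDiff_X_hi, polySwap_X, simpleRefl_hi]; ring

theorem dem_X_mul_of_ne {i : Fin (r - 1)} {j : Fin r} (h : j ≠ lo i) (h' : j ≠ hi i)
    (f : Poly R r) : dem i (X j * f) = X j * dem i f :=
  dem_mul_of_polySwap_eq (by rw [polySwap_X, simpleRefl_of_ne h h']) f

theorem dem_dem (i : Fin (r - 1)) (f : Poly R r) : dem i (dem i f) = dem i f := by
  rw [dem_apply i f, dem_X_hi_mul, dem_eq_zero (polySwap_divDiff i f), mul_zero, zero_add]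

/-- This identity cancels the multiplications by `X_{i+1}` in `reflection_coeff`, leaving only terms
with the cyclotomic polynomial. -/
theorem polySwap_dem_add_dem_polySwap (i : Fin (r - 1)) (f : Poly R r) :
    polySwap i (dem i f) + dem i (polySwap i f) = polySwap i f - f := by
  rw [dem_apply, dem_apply, map_mul, polySwap_X, simpleRefl_hi, polySwap_divDiff, divDiff_polySwap]
  linear_combination -mul_divDiff i f

/-- The polynomial representation: `f` is an eigenvector of eigenvalue `q` exactly if `f` is
symmetric in `X_i` and `X_{i+1}`. -/
theorem polySwap_eq_of_eigen {q : R} {i : Fin (r - 1)} {f : Poly R r}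
    (h : q • polySwap i f + (q - 1) • dem i f = q • f) : polySwap i f = f := by
  have h0 : (X (hi i) - C q * X (lo i)) * divDiff i f = 0 := by
    have h1 := mul_divDiff i f
    rw [dem_apply] at h
    simp only [smul_eq_C_mul, C_sub, C_1] at h
    linear_combination -h + C q * h1
  have h1 : divDiff i f = 0 :=
    (isRegular_X_sub_C_mul_X (lo_ne_hi i) q).left (by simpa only [mul_zero] using h0)
  have h2 := mul_divDiff i f
  rw [h1, mul_zero] at h2
  exact (sub_eq_zero.mp h2.symm).symm

/-! ### Polynomials with bounded exponents -/

variable (R) in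
/-- Polynomials whose exponent in the variable `X_j` is less than `d j`, for all `j`. -/
noncomputable def box (d : Fin r → ℕ) : Submodule R (Poly R r) :=
  restrictSupport R {s | ∀ j, s j < d j}

theorem mem_box {d : Fin r → ℕ} {f : Poly R r} :
    f ∈ box R d ↔ ∀ s ∈ f.support, ∀ j, s j < d j := by
  rw [box, restrictSupport, AddMonoidAlgebra.mem_supported]
  rfl

theorem box_mono {d d' : Fin r → ℕ} (h : d ≤ d') : box R d ≤ box R d' :=
  fun _ hf ↦ mem_box.mpr fun s hs j ↦ (mem_box.mp hf s hs j).trans_le (h j)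

theorem monomial_mem_box {d : Fin r → ℕ} {s : Fin r →₀ ℕ} (h : ∀ j, s j < d j) (c : R) :
    monomial s c ∈ box R d := by
  refine mem_box.mpr fun t ht ↦ ?_
  rw [Finset.mem_singleton.mp (support_monomial_subset ht)]
  exact h

/-- A linear condition on a bounded polynomial may be tested on monomials. -/
theorem box_induction {d : Fin r → ℕ} {W : Submodule R (Poly R r)}
    (h : ∀ s : Fin r →₀ ℕ, (∀ j, s j < d j) → monomial s 1 ∈ W) : box R d ≤ W := by
  intro f hf
  rw [f.as_sum]
  refine Submodule.sum_mem _ fun s hs ↦ ?_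
  rw [← mul_one (coeff s f), ← smul_eq_mul, ← smul_monomial]
  exact W.smul_mem _ (h s (mem_box.mp hf s hs))

theorem X_mul_mem_box {d d' : Fin r → ℕ} {f : Poly R r} (hf : f ∈ box R d) (a : Fin r)
    (h : ∀ j, j ≠ a → d j ≤ d' j) (h' : d a + 1 ≤ d' a) : X a * f ∈ box R d' := by
  refine box_induction (W := (box R d').comap (LinearMap.mulLeft R (X a))) (fun s hs ↦ ?_) hf
  rw [Submodule.mem_comap, LinearMap.mulLeft_apply, X, monomial_mul]
  refine monomial_mem_box (fun j ↦ ?_) _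
  rw [Finsupp.add_apply]
  by_cases hj : j = a
  · subst hj; have := hs j; simp; omega
  · have := hs j; have := h j hj; simp [Ne.symm hj]; omega

theorem polySwap_mem_box {d d' : Fin r → ℕ} {f : Poly R r} (hf : f ∈ box R d) (i : Fin (r - 1))
    (h : ∀ j, d (simpleRefl i j) ≤ d' j) : polySwap i f ∈ box R d' := by
  refine box_induction (W := (box R d').comap (polySwap i).toLinearMap) (fun s hs ↦ ?_) hf
  rw [Submodule.mem_comap, AlgHom.toLinearMap_apply, polySwap, rename_monomial]
  refine monomial_mem_box (fun j ↦ ?_) _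
  obtain ⟨j, rfl⟩ := (simpleRefl i).surjective j
  rw [Finsupp.mapDomain_apply (simpleRefl i).injective]
  exact (hs j).trans_le (by simpa using h (simpleRefl i j))

theorem polySwap_monomial {i : Fin (r - 1)} {s : Fin r →₀ ℕ} (h : s (lo i) = s (hi i)) (c : R) :
    polySwap i (monomial s c) = monomial s c := by
  rw [polySwap, rename_monomial]
  refine congrArg (fun t ↦ monomial t c) (Finsupp.ext fun j ↦ ?_)
  obtain ⟨j, rfl⟩ := (simpleRefl i).surjective j
  rw [Finsupp.mapDomain_apply (simpleRefl i).injective]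
  by_cases h1 : j = lo i
  · subst h1; rw [simpleRefl_lo, h]
  · by_cases h2 : j = hi i
    · subst h2; rw [simpleRefl_hi, h]
    · rw [simpleRefl_of_ne h1 h2]

/-- `D_i` kills monomials symmetric in the two variables; otherwise one factor of the variable with
the larger exponent is peeled off. The point is the asymmetry: the exponent of `X_i` falls strictly
below the maximum, which leaves room for one multiplication by `X_i` without reduction. -/
theorem dem_monomial_mem_box (i : Fin (r - 1)) (s : Fin r →₀ ℕ) :
    dem i (monomial s (1 : R)) ∈ box R (fun j ↦ if j = lo i then max (s (lo i)) (s (hi i)) else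
      if j = hi i then max (s (lo i)) (s (hi i)) + 1 else s j + 1) := by
  have hne := lo_ne_hi i
  induction hn : s (lo i) + s (hi i) generalizing s with
  | zero =>
    rw [dem_eq_zero (polySwap_monomial (by omega) 1)]
    exact Submodule.zero_mem _
  | succ n ih =>
    rcases lt_trichotomy (s (lo i)) (s (hi i)) with h | h | h
    · obtain ⟨s', rfl⟩ : ∃ s', s = Finsupp.single (hi i) 1 + s' :=
        exists_add_of_le (by simpa using (by omega : 1 ≤ s (hi i)))
      have e : (monomial (Finsupp.single (hi i) 1 + s') (1 : R) : Poly R r) =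
          X (hi i) * monomial s' 1 := by rw [X, monomial_mul, one_mul]
      simp only [Finsupp.add_apply, Finsupp.single_eq_same, Finsupp.single_eq_of_ne hne] at h hn
      rw [e, dem_X_hi_mul]
      refine Submodule.add_mem _ (X_mul_mem_box (ih s' (by omega)) _ (fun j hj ↦ ?_) ?_) ?_
      · simp only [Finsupp.add_apply, Finsupp.single_eq_same, Finsupp.single_eq_of_ne hne]
        split_ifs <;> simp_all <;> omega
      · simp [hne]; omega
      · rw [← e]
        refine monomial_mem_box (fun j ↦ ?_) _
        split_ifs with h1 h2
        · subst h1; simp [hne]; omega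
        · subst h2; simp [hne.symm]
        · omega
    · rw [dem_eq_zero (polySwap_monomial (by omega) 1)]
      exact Submodule.zero_mem _
    · obtain ⟨s', rfl⟩ : ∃ s', s = Finsupp.single (lo i) 1 + s' :=
        exists_add_of_le (by simpa using (by omega : 1 ≤ s (lo i)))
      have e : (monomial (Finsupp.single (lo i) 1 + s') (1 : R) : Poly R r) =
          X (lo i) * monomial s' 1 := by rw [X, monomial_mul, one_mul]
      simp only [Finsupp.add_apply, Finsupp.single_eq_same, Finsupp.single_eq_of_ne hne.symm] at h hn
      rw [e, dem_X_lo_mul]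
      refine Submodule.sub_mem _ (X_mul_mem_box (ih s' (by omega)) _ (fun j hj ↦ ?_) ?_)
        (X_mul_mem_box (monomial_mem_box (d := fun j ↦ s' j + 1) (fun j ↦ by simp) 1) _
          (fun j hj ↦ ?_) ?_)
      · simp only [Finsupp.add_apply, Finsupp.single_eq_same, Finsupp.single_eq_of_ne hne.symm]
        split_ifs <;> simp_all <;> omega
      · simp [hne.symm]; omega
      · simp only [Finsupp.add_apply, Finsupp.single_eq_same, Finsupp.single_eq_of_ne hne.symm]
        split_ifs <;> simp_all
      · simp [hne.symm]; omega

theorem dem_mem_box {d d' : Fin r → ℕ} {f : Poly R r} (hf : f ∈ box R d) (i : Fin (r - 1)) {M : ℕ}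
    (hlo : d (lo i) ≤ M) (hhi : d (hi i) ≤ M) (h : ∀ j, j ≠ lo i → j ≠ hi i → d j ≤ d' j)
    (hlo' : M ≤ d' (lo i) + 1) (hhi' : M ≤ d' (hi i)) : dem i f ∈ box R d' := by
  refine box_induction (W := (box R d').comap (dem i)) (fun s hs ↦ ?_) hf
  refine box_mono (fun j ↦ ?_) (dem_monomial_mem_box i s)
  have h1 := hs (lo i)
  have h2 := hs (hi i)
  dsimp only
  split_ifs with h3 h4
  · subst h3; omega
  · subst h4; omega
  · exact (hs j).trans_le (h j h3 h4)

/-! ### Coefficients with respect to one variable -/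

/-- The coefficient of `X_a ^ M`, a polynomial without `X_a`. -/
noncomputable def coeffAt (a : Fin r) (M : ℕ) : Poly R r →ₗ[R] Poly R r :=
  (basisMonomials (Fin r) R).constr R fun s ↦ if s a = M then monomial (s.erase a) 1 else 0

theorem coeffAt_monomial (a : Fin r) (M : ℕ) (s : Fin r →₀ ℕ) :
    coeffAt a M (monomial s (1 : R)) = if s a = M then monomial (s.erase a) 1 else 0 := by
  have := (basisMonomials (Fin r) R).constr_basis R
    (fun s ↦ if s a = M then (monomial (s.erase a) 1 : Poly R r) else 0) s
  rwa [coe_basisMonomials] at this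

theorem linearMap_ext_monomial {N : Type*} [AddCommMonoid N] [Module R N] {φ ψ : Poly R r →ₗ[R] N}
    (h : ∀ s, φ (monomial s 1) = ψ (monomial s 1)) : φ = ψ :=
  (basisMonomials (Fin r) R).ext fun s ↦ by simpa using h s

theorem coeffAt_eq_zero {d : Fin r → ℕ} {a : Fin r} {M : ℕ} (h : d a ≤ M) {f : Poly R r}
    (hf : f ∈ box R d) : coeffAt a M f = 0 := by
  refine box_induction (W := LinearMap.ker (coeffAt a M)) (fun s hs ↦ ?_) hf
  rw [LinearMap.mem_ker, coeffAt_monomial, if_neg]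
  have := hs a
  omega

theorem coeffAt_mem_box {d d' : Fin r → ℕ} {a : Fin r} (M : ℕ) (h : ∀ j, j ≠ a → d j ≤ d' j)
    (h' : 1 ≤ d' a) {f : Poly R r} (hf : f ∈ box R d) : coeffAt a M f ∈ box R d' := by
  refine box_induction (W := (box R d').comap (coeffAt a M)) (fun s hs ↦ ?_) hf
  rw [Submodule.mem_comap, coeffAt_monomial]
  split_ifs
  · refine monomial_mem_box (fun j ↦ ?_) _
    by_cases hj : j = a
    · subst hj; simp; omega
    · rw [Finsupp.erase_ne hj]
      exact (hs j).trans_le (h j hj)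
  · exact Submodule.zero_mem _

theorem coeffAt_X_mul {a b : Fin r} (h : b ≠ a) (M : ℕ) (f : Poly R r) :
    coeffAt a M (X b * f) = X b * coeffAt a M f := by
  have : coeffAt a M ∘ₗ LinearMap.mulLeft R (X b) =
      LinearMap.mulLeft R (X b : Poly R r) ∘ₗ coeffAt a M := by
    refine linearMap_ext_monomial fun s ↦ ?_
    simp only [LinearMap.comp_apply, LinearMap.mulLeft_apply, coeffAt_monomial]
    rw [X, monomial_mul, one_mul, coeffAt_monomial]
    simp only [Finsupp.add_apply, Finsupp.single_eq_of_ne h.symm, zero_add]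
    split_ifs
    · rw [monomial_mul, one_mul, Finsupp.erase_add, Finsupp.erase_single_ne h.symm]
    · rw [mul_zero]
  exact congrArg (fun φ ↦ φ f) this

theorem coeffAt_comm {a b : Fin r} (h : b ≠ a) (M M' : ℕ) (f : Poly R r) :
    coeffAt a M (coeffAt b M' f) = coeffAt b M' (coeffAt a M f) := by
  have : coeffAt a M ∘ₗ coeffAt b M' = coeffAt (R := R) b M' ∘ₗ coeffAt a M := by
    refine linearMap_ext_monomial fun s ↦ ?_
    simp only [LinearMap.comp_apply, coeffAt_monomial, apply_ite (coeffAt a M),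
      apply_ite (coeffAt b M'), map_zero, Finsupp.erase_ne h, Finsupp.erase_ne h.symm]
    have : (s.erase a).erase b = (s.erase b).erase a := by
      ext j; simp only [Finsupp.erase_apply]; split_ifs <;> rfl
    rw [this]
    split_ifs <;> rfl
  exact congrArg (fun φ ↦ φ f) this

theorem coeffAt_polySwap (i : Fin (r - 1)) (a : Fin r) (M : ℕ) (f : Poly R r) :
    coeffAt a M (polySwap i f) = polySwap i (coeffAt (simpleRefl i a) M f) := by
  have : coeffAt a M ∘ₗ (polySwap i).toLinearMap =
      (polySwap (R := R) i).toLinearMap ∘ₗ coeffAt (simpleRefl i a) M := by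
    refine linearMap_ext_monomial fun s ↦ ?_
    simp only [LinearMap.comp_apply, AlgHom.toLinearMap_apply, coeffAt_monomial, polySwap,
      rename_monomial]
    have h1 : Finsupp.mapDomain (simpleRefl i) s a = s (simpleRefl i a) := by
      conv_lhs => rw [← simpleRefl_apply_apply i a]
      exact Finsupp.mapDomain_apply (simpleRefl i).injective _ _
    rw [h1]
    split_ifs
    swap
    · rw [map_zero]
    rw [rename_monomial]
    refine congrArg (fun t ↦ monomial t (1 : R)) (Finsupp.ext fun j ↦ ?_)
    obtain ⟨j, rfl⟩ := (simpleRefl i).surjective j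
    rw [Finsupp.mapDomain_apply (simpleRefl i).injective, Finsupp.erase_apply, Finsupp.erase_apply,
      Finsupp.mapDomain_apply (simpleRefl i).injective]
    have : simpleRefl i j = a ↔ j = simpleRefl i a :=
      ⟨fun h ↦ by rw [← h, simpleRefl_apply_apply], fun h ↦ by rw [h, simpleRefl_apply_apply]⟩
    simp only [this]
  exact congrArg (fun φ ↦ φ f) this

theorem coeffAt_X_pow_mul {d : Fin r → ℕ} {a : Fin r} (M : ℕ) (h : d a ≤ 1) {f : Poly R r}
    (hf : f ∈ box R d) : coeffAt a M (X a ^ M * f) = f := by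
  refine box_induction (W := LinearMap.eqLocus (coeffAt a M ∘ₗ LinearMap.mulLeft R (X a ^ M))
    LinearMap.id) (fun s hs ↦ ?_) hf
  have h0 : s a = 0 := by have := hs a; omega
  rw [LinearMap.mem_eqLocus, LinearMap.comp_apply, LinearMap.mulLeft_apply, X_pow_eq_monomial,
    monomial_mul, one_mul, coeffAt_monomial, if_pos (by simp [h0]), Finsupp.erase_add,
    Finsupp.erase_single, zero_add, Finsupp.erase_of_notMem_support (by simpa using h0)]
  rfl

/-- Taking a coefficient in `X_a` is linear over the other variables and commutes with `s_i`, so it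
respects the equation that characterises `divDiff`. -/
theorem coeffAt_dem_of_ne {i : Fin (r - 1)} {a : Fin r} (h : a ≠ lo i) (h' : a ≠ hi i) (M : ℕ)
    (f : Poly R r) : coeffAt a M (dem i f) = dem i (coeffAt a M f) := by
  rw [dem_apply, coeffAt_X_mul h'.symm, dem_apply]
  congr 1
  refine (divDiff_eq_of_mul_eq ?_).symm
  rw [sub_mul, ← coeffAt_X_mul h'.symm, ← coeffAt_X_mul h.symm, ← map_sub, ← sub_mul, mul_divDiff,
    map_sub, coeffAt_polySwap, simpleRefl_of_ne h h']

end Polynomials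

/-! ### Multiplication by a variable modulo the cyclotomic polynomial, and its reflection equation.
-/

section CyclotomicOperator

open MvPolynomial

variable {R : Type*} [CommRing R] {r m : ℕ} (u : Fin m → R)

/-- The cyclotomic polynomial `(X_a - u_1) ⋯ (X_a - u_m)`. -/
noncomputable def cyc (a : Fin r) : Poly R r := ∏ k, (X a - C (u k))

/-- A monic polynomial of degree `m` in one variable is evaluated at `X_a`; the expansion separates
the top power from terms that stay below exponent `m`. -/
theorem cyc_expand (a : Fin r) : ∃ c : ℕ → R,
    (cyc u a : Poly R r) = X a ^ m + ∑ j ∈ Finset.range m, C (c j) * X a ^ j := by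
  nontriviality R
  let p : Polynomial R := ∏ k, (Polynomial.X - Polynomial.C (u k))
  have hp : p.Monic := Polynomial.monic_prod_X_sub_C _ _
  have hd : p.natDegree = m := by
    rw [Polynomial.natDegree_finsetProd_X_sub_C_eq_card]; simp
  refine ⟨p.coeff, ?_⟩
  have h1 : Polynomial.aeval (X a : Poly R r) p = cyc u a := by
    simp [p, cyc, map_prod]
  rw [← h1]
  conv_lhs => rw [hp.as_sum, hd]
  simp [MvPolynomial.algebraMap_eq]

theorem polySwap_cyc (i : Fin (r - 1)) (a : Fin r) :
    polySwap i (cyc u a) = cyc u (simpleRefl i a) := by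
  simp only [cyc, map_prod, map_sub, polySwap_X]
  simp [polySwap]

theorem coeffAt_cyc_mul {a b : Fin r} (h : b ≠ a) (M : ℕ) (f : Poly R r) :
    coeffAt a M (cyc u b * f) = cyc u b * coeffAt a M f := by
  refine Finset.prod_induction (fun k ↦ (X b - C (u k) : Poly R r))
    (fun g ↦ ∀ f, coeffAt a M (g * f) = g * coeffAt a M f) (fun g g' hg hg' f ↦ ?_) (fun f ↦ ?_)
    (fun k _ f ↦ ?_) f
  · rw [mul_assoc, hg, hg', mul_assoc]
  · rw [one_mul, one_mul]
  · rw [sub_mul, map_sub, coeffAt_X_mul h, C_mul', map_smul, sub_mul, C_mul']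

theorem X_pow_mul_mem_box {d d' : Fin r → ℕ} {f : Poly R r} (hf : f ∈ box R d) (a : Fin r) (k : ℕ)
    (h : ∀ j, j ≠ a → d j ≤ d' j) (h' : d a + k ≤ d' a) : X a ^ k * f ∈ box R d' := by
  induction k generalizing d' with
  | zero =>
    rw [pow_zero, one_mul]
    refine box_mono (fun j ↦ ?_) hf
    by_cases hj : j = a
    · subst hj; simpa using h'
    · exact h j hj
  | succ k ih =>
    rw [pow_succ', mul_assoc]
    refine X_mul_mem_box (ih (d' := Function.update d' a (d a + k)) (fun j hj ↦ ?_) ?_) a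
      (fun j hj ↦ ?_) ?_
    · simpa [hj] using h j hj
    · simp
    · simp [hj]
    · simp; omega

/-- Multiplication by `X_a`, reduced modulo the cyclotomic polynomial in `X_a`; this is meant for
polynomials whose exponents are less than `m`. -/
noncomputable def cycMul (a : Fin r) : Poly R r →ₗ[R] Poly R r :=
  LinearMap.mulLeft R (X a) - LinearMap.mulLeft R (cyc u a) ∘ₗ coeffAt a (m - 1)

theorem cycMul_apply (a : Fin r) (f : Poly R r) :
    cycMul u a f = X a * f - cyc u a * coeffAt a (m - 1) f := rfl

theorem cycMul_eq_X_mul {d : Fin r → ℕ} {a : Fin r} (h : d a ≤ m - 1) {f : Poly R r}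
    (hf : f ∈ box R d) : cycMul u a f = X a * f := by
  rw [cycMul_apply, coeffAt_eq_zero h hf, mul_zero, sub_zero]

variable (R r m) in
/-- Polynomials with all exponents less than `m`. -/
noncomputable abbrev trunc : Submodule R (Poly R r) := box R fun _ : Fin r ↦ m

theorem polySwap_mem_trunc {f : Poly R r} (hf : f ∈ trunc R r m) (i : Fin (r - 1)) :
    polySwap i f ∈ trunc R r m := polySwap_mem_box hf i fun _ ↦ le_rfl

/-- The exponent of `X_i` drops under `dem i`. -/
theorem dem_mem_box_update {f : Poly R r} (hf : f ∈ trunc R r m) (i : Fin (r - 1)) :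
    dem i f ∈ box R (Function.update (fun _ ↦ m) (lo i) (m - 1)) :=
  dem_mem_box hf i le_rfl le_rfl (fun j h _ ↦ by simp [h]) (by simp; omega)
    (by simp [(lo_ne_hi i).symm])

theorem dem_mem_trunc {f : Poly R r} (hf : f ∈ trunc R r m) (i : Fin (r - 1)) :
    dem i f ∈ trunc R r m :=
  box_mono (update_le_self_iff.mpr (Nat.sub_le _ _)) (dem_mem_box_update hf i)

/-- Only monomials with exponent `m - 1` in `X_a` can overflow, and for these the top term `X_a ^ m`
cancels against that of the cyclotomic polynomial. -/
theorem cycMul_mem_trunc (hm : 1 ≤ m) {f : Poly R r} (hf : f ∈ trunc R r m) (a : Fin r) :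
    cycMul u a f ∈ trunc R r m := by
  refine box_induction (W := (trunc R r m).comap (cycMul u a)) (fun s hs ↦ ?_) hf
  rw [Submodule.mem_comap]
  by_cases h : s a = m - 1
  · obtain ⟨c, hc⟩ := cyc_expand (R := R) u a
    rw [cycMul_apply, coeffAt_monomial, if_pos h]
    have h1 : (monomial s 1 : Poly R r) = X a ^ (m - 1) * monomial (s.erase a) 1 := by
      rw [X_pow_eq_monomial, monomial_mul, one_mul, ← h, Finsupp.single_add_erase]
    have h2 : X a * (monomial s 1 : Poly R r) - cyc u a * monomial (s.erase a) 1 =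
        -∑ j ∈ Finset.range m, c j • (X a ^ j * monomial (s.erase a) 1) := by
      have h3 : (X a : Poly R r) * X a ^ (m - 1) = X a ^ m := by
        rw [← pow_succ']; congr 1; omega
      rw [h1, hc, ← mul_assoc, h3, add_mul, Finset.sum_mul]
      simp only [smul_eq_C_mul, mul_assoc]
      ring
    rw [h2]
    refine Submodule.neg_mem _ (Submodule.sum_mem _ fun j hj ↦ Submodule.smul_mem _ _ ?_)
    rw [X_pow_eq_monomial, monomial_mul, one_mul]
    refine monomial_mem_box (fun b ↦ ?_) _
    by_cases hb : b = a
    · subst hb; simpa using hj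
    · rw [Finsupp.add_apply, Finsupp.erase_ne hb, Finsupp.single_eq_of_ne hb]
      simpa using hs b
  · have h1 : (monomial s 1 : Poly R r) ∈ box R (Function.update (fun _ ↦ m) a (m - 1)) :=
      monomial_mem_box (fun j ↦ by
        have := hs j
        by_cases hj : j = a
        · subst hj; simp; omega
        · simpa [hj] using this) _
    rw [cycMul_eq_X_mul u (by simp) h1]
    exact X_mul_mem_box h1 a (fun j hj ↦ by simp [hj]) (by simp; omega)

theorem coeffAt_dem {f : Poly R r} (hf : f ∈ trunc R r m) (i : Fin (r - 1)) :
    coeffAt (lo i) (m - 1) (dem i f) = 0 := coeffAt_eq_zero (by simp) (dem_mem_box_update hf i)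

theorem cycMul_dem {f : Poly R r} (hf : f ∈ trunc R r m) (i : Fin (r - 1)) :
    cycMul u (lo i) (dem i f) = X (lo i) * dem i f :=
  cycMul_eq_X_mul u (by simp) (dem_mem_box_update hf i)

/-- This makes the `(q - 1)^2` term of `T_i L_i T_i` vanish in `indT_cycMul_indT`. -/
theorem dem_cycMul_dem {f : Poly R r} (hf : f ∈ trunc R r m) (i : Fin (r - 1)) :
    dem i (cycMul u (lo i) (dem i f)) = 0 := by
  rw [cycMul_dem u hf, dem_X_lo_mul, dem_dem, sub_self]

/-- Here `h` does not involve `X_i`. The terms `X_i ^ j h` with `j < m` contribute nothing, because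
`D_i` lowers the bound on the exponent of `X_i`. Only `X_i ^ m h` survives, through the correction
term of `dem_X_lo_mul`. -/
theorem coeffAt_dem_cyc_mul (hm : 1 ≤ m) {i : Fin (r - 1)} {h : Poly R r}
    (hh : h ∈ box R (Function.update (fun _ ↦ m) (lo i) 1)) :
    coeffAt (lo i) (m - 1) (dem i (cyc u (lo i) * h)) = -(X (hi i) * h) := by
  obtain ⟨c, hc⟩ := cyc_expand (R := R) u (lo i)
  have hmem : ∀ j < m, X (lo i) ^ j * h ∈ trunc R r m := fun j hj ↦
    X_pow_mul_mem_box hh _ _ (fun b hb ↦ by simp [hb]) (by simp; omega)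
  have h3 : (X (lo i) : Poly R r) ^ m * h = X (lo i) * (X (lo i) ^ (m - 1) * h) := by
    rw [← mul_assoc, ← pow_succ']; congr 2; omega
  rw [hc, add_mul, Finset.sum_mul, map_add, map_add, map_sum, map_sum,
    Finset.sum_eq_zero fun j hj ↦ ?_, add_zero, h3, dem_X_lo_mul, map_sub,
    coeffAt_X_mul (lo_ne_hi i).symm, coeffAt_X_mul (lo_ne_hi i).symm,
    coeffAt_dem (hmem _ (by omega)), coeffAt_X_pow_mul _ (by simp) hh, mul_zero, zero_sub]
  rw [mul_assoc, C_mul', map_smul, map_smul, coeffAt_dem (hmem j (Finset.mem_range.mp hj)),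
    smul_zero]

theorem polySwap_cycMul_polySwap (i : Fin (r - 1)) (a : Fin r) (f : Poly R r) :
    polySwap i (cycMul u a (polySwap i f)) = cycMul u (simpleRefl i a) f := by
  rw [cycMul_apply, cycMul_apply, map_sub, map_mul, map_mul, polySwap_polySwap, polySwap_X,
    polySwap_cyc, coeffAt_polySwap, polySwap_polySwap]

theorem cycMul_comm {a b : Fin r} (h : a ≠ b) (f : Poly R r) :
    cycMul u a (cycMul u b f) = cycMul u b (cycMul u a f) := by
  simp only [cycMul_apply, map_sub, coeffAt_X_mul h, coeffAt_X_mul h.symm, coeffAt_cyc_mul u h,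
    coeffAt_cyc_mul u h.symm, coeffAt_comm h]
  ring

/-- The coefficient operator that appears in the reflection equation for `cycMul`. -/
theorem reflection_coeff {f : Poly R r} (hf : f ∈ trunc R r m) (i : Fin (r - 1)) :
    polySwap i (cycMul u (lo i) (polySwap i f)) + dem i (cycMul u (lo i) (polySwap i f)) +
        polySwap i (cycMul u (lo i) (dem i f)) =
      -(cyc u (hi i) * coeffAt (hi i) (m - 1) f +
        dem i (cyc u (lo i) * polySwap i (coeffAt (hi i) (m - 1) f))) := by
  rw [polySwap_cycMul_polySwap, simpleRefl_lo, cycMul_dem u hf, cycMul_apply, cycMul_apply, map_sub,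
    dem_X_lo_mul, map_mul (polySwap i), polySwap_X, simpleRefl_lo, coeffAt_polySwap, simpleRefl_lo]
  linear_combination (X (hi i)) * polySwap_dem_add_dem_polySwap i f

/-- This is the `(q - 1)` part of the reflection equation. By `reflection_coeff` the operator
depends on `f` only through its coefficient `c` at `X_{i+1} ^ (m - 1)`. Applying `cycMul` to `f`
first replaces `c` by its own reduced product with `X_i`, and the two sides can be compared
explicitly. -/
theorem reflection_coeff_comm (hm : 1 ≤ m) {f : Poly R r} (hf : f ∈ trunc R r m) (i : Fin (r - 1)) :
    cycMul u (lo i) (polySwap i (cycMul u (lo i) (polySwap i f)) +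
        dem i (cycMul u (lo i) (polySwap i f)) + polySwap i (cycMul u (lo i) (dem i f))) =
      polySwap i (cycMul u (lo i) (polySwap i (cycMul u (lo i) f))) +
        dem i (cycMul u (lo i) (polySwap i (cycMul u (lo i) f))) +
        polySwap i (cycMul u (lo i) (dem i (cycMul u (lo i) f))) := by
  have hne := lo_ne_hi i
  rw [reflection_coeff u hf, reflection_coeff u (cycMul_mem_trunc u hm hf _)]
  set c := coeffAt (hi i) (m - 1) f with hc
  have hh : polySwap i c ∈ box R (Function.update (fun _ ↦ m) (lo i) 1) := by
    refine polySwap_mem_box (coeffAt_mem_box (m - 1) (d' := Function.update (fun _ ↦ m) (hi i) 1)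
      (fun j hj ↦ ?_) ?_ hf) i (fun j ↦ ?_)
    · simp [hj]
    · simp
    · by_cases hj : j = lo i
      · subst hj; simp
      · have : simpleRefl i j ≠ hi i := fun h ↦ hj (by
          rw [← simpleRefl_apply_apply i j, h, simpleRefl_hi])
        simp [hj, this]
  have hcc : coeffAt (hi i) (m - 1) (cycMul u (lo i) f) =
      X (lo i) * c - cyc u (lo i) * coeffAt (lo i) (m - 1) c := by
    rw [cycMul_apply, map_sub, coeffAt_X_mul hne, coeffAt_cyc_mul u hne, coeffAt_comm hne]
  set g := coeffAt (lo i) (m - 1) c with hg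
  -- Both variables have been removed from `g`, so `g` times the two cyclotomic polynomials is
  -- symmetric and is killed by `D_i`.
  have hgs : polySwap i g = g := by
    have hg0 : g ∈ box R (Function.update (Function.update (fun _ ↦ m) (hi i) 1) (lo i) 1) :=
      coeffAt_mem_box (m - 1) (fun j hj ↦ by simp [hj]) (by simp)
        (coeffAt_mem_box (m - 1) (d' := Function.update (fun _ ↦ m) (hi i) 1)
          (fun j hj ↦ by simp [hj]) (by simp) hf)
    refine box_induction (W := LinearMap.eqLocus (polySwap i).toLinearMap LinearMap.id)
      (fun s hs ↦ ?_) hg0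
    have h1 := hs (lo i)
    have h2 := hs (hi i)
    simp [hne.symm] at h1 h2
    exact polySwap_monomial (by omega) 1
  have hsym : polySwap i (cyc u (lo i) * cyc u (hi i) * g) = cyc u (lo i) * cyc u (hi i) * g := by
    rw [map_mul, map_mul, polySwap_cyc, polySwap_cyc, simpleRefl_lo, simpleRefl_hi, hgs,
      mul_comm (cyc u (hi i))]
  have hd : dem i (cyc u (lo i) * polySwap i (X (lo i) * c - cyc u (lo i) * g)) =
      X (hi i) * (cyc u (lo i) * polySwap i c) + X (lo i) * dem i (cyc u (lo i) * polySwap i c) := by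
    rw [map_sub, map_mul (polySwap i), map_mul (polySwap i), polySwap_X, polySwap_cyc, simpleRefl_lo,
      hgs, mul_sub, map_sub,
      ← mul_assoc (cyc u (lo i)) (cyc u (hi i)), dem_eq_zero hsym, sub_zero,
      mul_left_comm, dem_X_hi_mul]
    ring
  rw [hcc, hd, map_neg, map_add, cycMul_apply, cycMul_apply, coeffAt_cyc_mul u hne.symm,
    coeffAt_dem_cyc_mul u hm hh]
  ring

theorem polySwap_cycMul_of_ne {i : Fin (r - 1)} {a : Fin r} (h : a ≠ lo i) (h' : a ≠ hi i)
    (f : Poly R r) : polySwap i (cycMul u a f) = cycMul u a (polySwap i f) := by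
  rw [← polySwap_polySwap i (cycMul u a (polySwap i f)), polySwap_cycMul_polySwap,
    simpleRefl_of_ne h h']

theorem dem_cycMul_of_ne {i : Fin (r - 1)} {a : Fin r} (h : a ≠ lo i) (h' : a ≠ hi i)
    (f : Poly R r) : dem i (cycMul u a f) = cycMul u a (dem i f) := by
  rw [cycMul_apply, cycMul_apply, map_sub, dem_X_mul_of_ne h h', dem_mul_of_polySwap_eq,
    coeffAt_dem_of_ne h h']
  rw [polySwap_cyc, simpleRefl_of_ne h h']

end CyclotomicOperator

/-! ### Representations of the cyclotomic Hecke algebra -/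

section Presentation

variable {R : Type*} [CommRing R] {q : R} {m : ℕ} {u : Fin m → R} {r : ℕ}

theorem T_quadratic (i : Fin (r - 1)) : (T q u i + 1) * (T q u i - algebraMap R _ q) = 0 := by
  have := RingQuot.mkAlgHom_rel R (HeckeRel.quadratic (q := q) (u := u) i)
  rw [map_mul, map_add, map_sub, map_one, AlgHom.commutes, map_zero] at this
  exact this

theorem T_braid (i j : Fin (r - 1)) (h : (j : ℕ) = i + 1) :
    T q u i * T q u j * T q u i = T q u j * T q u i * T q u j := by
  have := RingQuot.mkAlgHom_rel R (HeckeRel.braid (q := q) (u := u) i j h)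
  simp only [map_mul] at this
  exact this

theorem T_comm (i j : Fin (r - 1)) (h : (i : ℕ) + 1 < j) :
    T q u i * T q u j = T q u j * T q u i := by
  have := RingQuot.mkAlgHom_rel R (HeckeRel.commTT (q := q) (u := u) i j h)
  simp only [map_mul] at this
  exact this

theorem L_comm (i j : Fin r) : L q u i * L q u j = L q u j * L q u i := by
  have := RingQuot.mkAlgHom_rel R (HeckeRel.commLL (q := q) (u := u) i j)
  simp only [map_mul] at this
  exact this

theorem L_cyclotomic (j : Fin r) (h : (j : ℕ) = 0) :
    (List.ofFn fun k ↦ L q u j - algebraMap R _ (u k)).prod = 0 := by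
  have := RingQuot.mkAlgHom_rel R (HeckeRel.cyclotomic (q := q) (u := u) j h)
  rw [map_list_prod, List.map_ofFn, map_zero] at this
  refine Eq.trans (congrArg (fun l ↦ (List.ofFn l).prod) (funext fun k ↦ ?_)) this
  rw [Function.comp_apply, map_sub, AlgHom.commutes]
  rfl

theorem T_mul_L_mul_T (i : Fin (r - 1)) :
    T q u i * L q u (lo i) * T q u i = algebraMap R _ q * L q u (hi i) := by
  have := RingQuot.mkAlgHom_rel R (HeckeRel.TLT (q := q) (u := u) i)
  simp only [map_mul, AlgHom.commutes] at this
  exact this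

theorem L_mul_T_of_ne (i : Fin (r - 1)) (j : Fin r) (h : j ≠ lo i) (h' : j ≠ hi i) :
    L q u j * T q u i = T q u i * L q u j := by
  have := RingQuot.mkAlgHom_rel R (HeckeRel.commLT (q := q) (u := u) i j h h')
  simp only [map_mul] at this
  exact this

theorem T_mul_self (i : Fin (r - 1)) :
    T q u i * T q u i = (q - 1) • T q u i + q • (1 : Hecke q u r) := by
  have h := T_quadratic (q := q) (u := u) i
  rw [Algebra.algebraMap_eq_smul_one, add_mul, mul_sub, mul_smul_comm, mul_one, one_mul] at h
  calc T q u i * T q u i = (T q u i * T q u i - q • T q u i + (T q u i - q • 1)) +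
        ((q - 1) • T q u i + q • (1 : Hecke q u r)) := by module
    _ = _ := by rw [h, zero_add]

@[elab_as_elim]
theorem Hecke.induction {p : Hecke q u r → Prop} (algebraMap : ∀ c, p (algebraMap R _ c))
    (T : ∀ i, p (T q u i)) (L : ∀ j, p (L q u j)) (add : ∀ a b, p a → p b → p (a + b))
    (mul : ∀ a b, p a → p b → p (a * b)) (h : Hecke q u r) : p h := by
  obtain ⟨f, rfl⟩ := RingQuot.mkAlgHom_surjective R (HeckeRel q u r) h
  induction f using FreeAlgebra.induction with
  | grade0 c => rw [AlgHom.commutes]; exact algebraMap c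
  | grade1 x =>
    cases x with
    | T i => exact T i
    | L j => exact L j
  | mul a b ha hb => rw [map_mul]; exact mul _ _ ha hb
  | add a b ha hb => rw [map_add]; exact add _ _ ha hb

variable {A : Type*} [Ring A] [Algebra R A]

/-- The universal property of the cyclotomic Hecke algebra. -/
theorem exists_algHom (τ : Fin (r - 1) → A) (ℓ : Fin r → A)
    (quadratic : ∀ i, (τ i + 1) * (τ i - algebraMap R A q) = 0)
    (braid : ∀ i j : Fin (r - 1), (j : ℕ) = i + 1 → τ i * τ j * τ i = τ j * τ i * τ j)
    (commTT : ∀ i j : Fin (r - 1), (i : ℕ) + 1 < j → τ i * τ j = τ j * τ i)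
    (commLL : ∀ i j, ℓ i * ℓ j = ℓ j * ℓ i)
    (cyclotomic : ∀ j : Fin r, (j : ℕ) = 0 →
      (List.ofFn fun k ↦ ℓ j - algebraMap R A (u k)).prod = 0)
    (TLT : ∀ i, τ i * ℓ (lo i) * τ i = algebraMap R A q * ℓ (hi i))
    (commLT : ∀ i j, j ≠ lo i → j ≠ hi i → ℓ j * τ i = τ i * ℓ j) :
    ∃ φ : Hecke q u r →ₐ[R] A, (∀ i, φ (T q u i) = τ i) ∧ ∀ j, φ (L q u j) = ℓ j := by
  let g : Gen r → A := fun x ↦ Gen.casesOn x τ ℓ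
  have hT : ∀ i, FreeAlgebra.lift R g (freeT R i) = τ i := fun i ↦ FreeAlgebra.lift_ι_apply _ _
  have hL : ∀ i, FreeAlgebra.lift R g (freeL R i) = ℓ i := fun i ↦ FreeAlgebra.lift_ι_apply _ _
  have hrel : ∀ ⦃x y⦄, HeckeRel q u r x y → FreeAlgebra.lift R g x = FreeAlgebra.lift R g y := by
    intro x y hxy
    cases hxy with
    | quadratic i =>
      simp only [map_mul, map_add, map_sub, map_one, AlgHom.commutes, map_zero, hT, quadratic]
    | braid i j h => simp only [map_mul, hT, braid i j h]
    | commTT i j h => simp only [map_mul, hT, commTT i j h]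
    | commLL i j => simp only [map_mul, hL, commLL i j]
    | cyclotomic j h =>
      rw [map_list_prod, List.map_ofFn, map_zero, ← cyclotomic j h]
      congr 2
      funext k
      rw [Function.comp_apply, map_sub, AlgHom.commutes, hL]
    | TLT i => simp only [map_mul, hT, hL, AlgHom.commutes, TLT]
    | commLT i j h h' => simp only [map_mul, hT, hL, commLT i j h h']
  refine ⟨RingQuot.liftAlgHom R ⟨FreeAlgebra.lift R g, hrel⟩, fun i ↦ ?_, fun j ↦ ?_⟩
  · exact (RingQuot.liftAlgHom_mkAlgHom_apply R _ hrel _).trans (hT i)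
  · exact (RingQuot.liftAlgHom_mkAlgHom_apply R _ hrel _).trans (hL j)

/-! ### Jucys--Murphy elements from the type `B` presentation -/

/-- The elements `L_{n+1} = p T_n L_n T_n` generated by `L_1 = ℓ`, with `p` in place of `q⁻¹`. -/
def jucysMurphy (p : R) (τ : Fin (r - 1) → A) (ℓ : A) : ℕ → A
  | 0 => ℓ
  -- The value `0` at indices from `r` on belongs to no `L_j`; it lets the commutation lemmas hold
  -- for all natural numbers.
  | n + 1 => if h : n < r - 1 then
      p • (τ ⟨n, h⟩ * jucysMurphy p τ ℓ n * τ ⟨n, h⟩) else 0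

variable {p : R} {τ : Fin (r - 1) → A} {ℓ : A}

theorem jucysMurphy_succ (i : Fin (r - 1)) :
    jucysMurphy p τ ℓ (i + 1) = p • (τ i * jucysMurphy p τ ℓ i * τ i) := by
  rw [jucysMurphy, dif_pos i.2]

section TypeB

variable (braid : ∀ i j : Fin (r - 1), (j : ℕ) = i + 1 → τ i * τ j * τ i = τ j * τ i * τ j)
  (commTT : ∀ i j : Fin (r - 1), (i : ℕ) + 1 < j → τ i * τ j = τ j * τ i)
  (commLT : ∀ i : Fin (r - 1), 0 < (i : ℕ) → ℓ * τ i = τ i * ℓ)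
  (reflection : ∀ i : Fin (r - 1), (i : ℕ) = 0 → ℓ * τ i * ℓ * τ i = τ i * ℓ * τ i * ℓ)

include commTT commLT

theorem commute_jucysMurphy_of_lt (i : Fin (r - 1)) (n : ℕ) (h : n < i) :
    Commute (jucysMurphy p τ ℓ n) (τ i) := by
  induction n with
  | zero => exact commLT i h
  | succ n ih =>
    rw [jucysMurphy]
    split_ifs with hn
    · have h1 : Commute (τ ⟨n, hn⟩) (τ i) := commTT ⟨n, hn⟩ i h
      exact ((h1.mul_left (ih (by omega))).mul_left h1).smul_left p
    · exact Commute.zero_left _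

include braid

theorem commute_jucysMurphy_of_gt (i : Fin (r - 1)) (n : ℕ) (h : (i : ℕ) + 2 ≤ n) :
    Commute (jucysMurphy p τ ℓ n) (τ i) := by
  induction n, h using Nat.le_induction with
  | base =>
    rw [jucysMurphy]
    split_ifs with hn
    · rw [jucysMurphy_succ]
      set j : Fin (r - 1) := ⟨i + 1, hn⟩
      have hb := braid i j rfl
      have hc : jucysMurphy p τ ℓ i * τ j = τ j * jucysMurphy p τ ℓ i :=
        commute_jucysMurphy_of_lt commTT commLT j i (by simp [j])
      set x := jucysMurphy p τ ℓ i
      -- Conjugation by `T_i T_{i+1}` turns `T_i` into `T_{i+1}`, which commutes with the element `x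
      -- = L_i` built from earlier generators.
      have key : τ j * (τ i * x * τ i) * τ j * τ i = τ i * (τ j * (τ i * x * τ i) * τ j) := by
        calc τ j * (τ i * x * τ i) * τ j * τ i
            = τ j * τ i * x * (τ i * τ j * τ i) := by simp only [mul_assoc]
          _ = τ j * τ i * (x * τ j) * τ i * τ j := by rw [hb]; simp only [mul_assoc]
          _ = (τ j * τ i * τ j) * x * τ i * τ j := by rw [hc]; simp only [mul_assoc]
          _ = τ i * (τ j * (τ i * x * τ i) * τ j) := by rw [← hb]; simp only [mul_assoc]
      refine Commute.smul_left ?_ p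
      rw [mul_smul_comm, smul_mul_assoc]
      exact Commute.smul_left key p
    · exact Commute.zero_left _
  | succ n hn ih =>
    rw [jucysMurphy]
    split_ifs with hn'
    · have h1 : Commute (τ ⟨n, hn'⟩) (τ i) :=
        (commTT i ⟨n, hn'⟩ (by simp only; omega)).symm
      exact ((h1.mul_left ih).mul_left h1).smul_left p
    · exact Commute.zero_left _

include reflection

omit braid commTT in
theorem commute_jucysMurphy_zero (n : ℕ) : Commute ℓ (jucysMurphy p τ ℓ n) := by
  induction n with
  | zero => exact Commute.refl _
  | succ n ih =>
    rw [jucysMurphy]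
    split_ifs with hn
    · refine Commute.smul_right ?_ p
      by_cases h0 : n = 0
      · subst h0
        have := reflection ⟨0, hn⟩ rfl
        simpa only [Commute, SemiconjBy, mul_assoc, jucysMurphy] using this
      · have h1 : Commute ℓ (τ ⟨n, hn⟩) := commLT ⟨n, hn⟩ (by simp only; omega)
        exact (h1.mul_right ih).mul_right h1
    · exact Commute.zero_right _

/-- Induction on the smaller index: the next element is built from its predecessor and a `T` that
commutes with the later one. The reflection equation enters only through the base case
`commute_jucysMurphy_zero`. -/
theorem commute_jucysMurphy_jucysMurphy_of_lt (n k : ℕ) (h : n < k) :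
    Commute (jucysMurphy p τ ℓ n) (jucysMurphy p τ ℓ k) := by
  induction n with
  | zero => exact commute_jucysMurphy_zero commLT reflection k
  | succ n ih =>
    rw [jucysMurphy]
    split_ifs with hn
    · have h1 : Commute (τ ⟨n, hn⟩) (jucysMurphy p τ ℓ k) :=
        (commute_jucysMurphy_of_gt braid commTT commLT ⟨n, hn⟩ k (by simp only; omega)).symm
      exact ((h1.mul_left (ih (by omega))).mul_left h1).smul_left p
    · exact Commute.zero_left _

/-- A representation of the type `B` presentation extends to the cyclotomic Hecke algebra. -/
theorem exists_algHom_of_typeB (hpq : q * p = 1)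
    (quadratic : ∀ i, (τ i + 1) * (τ i - algebraMap R A q) = 0)
    (cyclotomic : 0 < r → (List.ofFn fun k ↦ ℓ - algebraMap R A (u k)).prod = 0) :
    ∃ φ : Hecke q u r →ₐ[R] A, (∀ i, φ (T q u i) = τ i) ∧
      ∀ j : Fin r, φ (L q u j) = jucysMurphy p τ ℓ j := by
  refine exists_algHom τ (fun j ↦ jucysMurphy p τ ℓ j) quadratic braid commTT (fun i j ↦ ?_)
    (fun j hj ↦ ?_) (fun i ↦ ?_) (fun i j h h' ↦ ?_)
  · rcases lt_trichotomy (i : ℕ) j with h | h | h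
    · exact commute_jucysMurphy_jucysMurphy_of_lt braid commTT commLT reflection _ _ h
    · rw [h]
    · exact (commute_jucysMurphy_jucysMurphy_of_lt braid commTT commLT reflection _ _ h).symm
  · simp only [hj, jucysMurphy]
    exact cyclotomic j.pos
  · have := jucysMurphy_succ (p := p) (τ := τ) (ℓ := ℓ) i
    simp only [hi, lo, this, Algebra.algebraMap_eq_smul_one, smul_mul_assoc, one_mul, smul_smul,
      hpq, one_smul]
  · rcases lt_or_ge (j : ℕ) i with hj | hj
    · exact commute_jucysMurphy_of_lt commTT commLT i j hj
    · refine commute_jucysMurphy_of_gt braid commTT commLT i j ?_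
      simp only [lo, hi, ne_eq, Fin.ext_iff] at h h'
      omega

end TypeB

end Presentation

/-! ### Polynomials in the Jucys--Murphy elements -/

section Evaluation

open MvPolynomial

variable {R : Type*} [CommRing R] {q : R} {m : ℕ} {u : Fin m → R} {r : ℕ}

variable (q u) in
/-- Evaluation of polynomials at the commuting elements `L_1, …, L_r`. -/
noncomputable def ev : Poly R r →ₐ[R] Hecke q u r :=
  letI : CommRing (Algebra.adjoin R (Set.range (L q u (r := r)))) :=
    { mul_comm := (Algebra.isMulCommutative_adjoin R (by
        rintro _ ⟨i, rfl⟩ _ ⟨j, rfl⟩; exact L_comm i j)).is_comm.comm }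
  (Algebra.adjoin R (Set.range (L q u (r := r)))).val.comp
    (aeval fun j ↦ (⟨L q u j, Algebra.subset_adjoin ⟨j, rfl⟩⟩ :
      Algebra.adjoin R (Set.range (L q u (r := r)))))

@[simp] theorem ev_X (j : Fin r) : ev q u (X j) = L q u j := by
  simp [ev]

theorem ev_mul_comm (f g : Poly R r) : ev q u f * ev q u g = ev q u g * ev q u f := by
  rw [← map_mul, mul_comm, map_mul]

theorem ev_cyc {a : Fin r} (h : (a : ℕ) = 0) : ev q u (cyc u a) = 0 := by
  rw [← L_cyclotomic (q := q) (u := u) a h, cyc, ← List.prod_ofFn, map_list_prod, List.map_ofFn]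
  refine congrArg (fun l ↦ (List.ofFn l).prod) (funext fun k ↦ ?_)
  rw [Function.comp_apply, map_sub, ev_X, ← MvPolynomial.algebraMap_eq, AlgHom.commutes]

/-- Multiply `T_i L_i T_i = q L_{i+1}` by `T_i` on the left, expand `T_i ^ 2` and cancel the unit
`q`. -/
theorem L_lo_mul_T (hq : IsUnit q) (i : Fin (r - 1)) :
    L q u (lo i) * T q u i = T q u i * L q u (hi i) - (q - 1) • L q u (hi i) := by
  have h1 := T_mul_L_mul_T (q := q) (u := u) i
  have h2 := T_mul_self (q := q) (u := u) i
  rw [Algebra.algebraMap_eq_smul_one, smul_mul_assoc, one_mul] at h1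
  have h3 : T q u i * T q u i * (L q u (lo i) * T q u i) = q • (T q u i * L q u (hi i)) := by
    rw [mul_assoc, ← mul_assoc (T q u i) (L q u _), h1, mul_smul_comm]
  rw [h2, add_mul, smul_mul_assoc, smul_mul_assoc, one_mul, ← mul_assoc, h1] at h3
  refine (hq.smul_left_cancel).mp ?_
  rw [smul_sub, ← h3, smul_comm q (q - 1)]
  abel

theorem L_hi_mul_T (hq : IsUnit q) (i : Fin (r - 1)) :
    L q u (hi i) * T q u i = T q u i * L q u (lo i) + (q - 1) • L q u (hi i) := by
  have h1 := T_mul_L_mul_T (q := q) (u := u) i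
  have h2 := T_mul_self (q := q) (u := u) i
  rw [Algebra.algebraMap_eq_smul_one, smul_mul_assoc, one_mul] at h1
  have h3 : T q u i * L q u (lo i) * (T q u i * T q u i) = q • (L q u (hi i) * T q u i) := by
    rw [← mul_assoc, h1, smul_mul_assoc]
  rw [h2, mul_add, mul_smul_comm, mul_smul_comm, mul_one, h1] at h3
  refine (hq.smul_left_cancel).mp ?_
  rw [smul_add, ← h3, smul_comm q (q - 1)]
  abel

/-- The Bernstein relation. -/
theorem ev_mul_T (hq : IsUnit q) (i : Fin (r - 1)) (f : Poly R r) :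
    ev q u f * T q u i = T q u i * ev q u (polySwap i f) + (q - 1) • ev q u (dem i f) := by
  induction f using MvPolynomial.induction_on with
  | C a =>
    rw [dem_eq_zero (by simp [polySwap]), map_zero, smul_zero, add_zero, polySwap, rename_C,
      ← MvPolynomial.algebraMap_eq, AlgHom.commutes]
    exact Algebra.commutes _ _
  | add f g hf hg => rw [map_add, add_mul, hf, hg]; simp only [map_add, mul_add, smul_add]; abel
  | mul_X f j hf =>
    by_cases h1 : j = lo i
    · subst h1
      rw [map_mul, map_mul, polySwap_X, simpleRefl_lo, mul_comm f, dem_X_lo_mul, ev_X, mul_assoc,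
        L_lo_mul_T hq, mul_sub, ← mul_assoc, hf, map_sub, map_mul, map_mul, map_mul, ev_X,
        add_mul, smul_sub, mul_smul_comm, smul_mul_assoc, ← ev_X (hi i), ev_mul_comm f,
        ev_mul_comm (dem i f), mul_assoc]
      abel
    · by_cases h2 : j = hi i
      · subst h2
        rw [map_mul, map_mul, polySwap_X, simpleRefl_hi, mul_comm f, dem_X_hi_mul, ev_X, mul_assoc,
          L_hi_mul_T hq, mul_add, ← mul_assoc, hf, map_add, map_mul, map_mul, map_mul, ev_X, ev_X,
          add_mul, smul_add, mul_smul_comm, smul_mul_assoc, ← ev_X (lo i), ← ev_X (hi i),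
          ev_mul_comm f, ev_mul_comm (dem i f), mul_assoc]
        abel
      · rw [map_mul, map_mul, polySwap_X, simpleRefl_of_ne h1 h2, mul_comm f, dem_X_mul_of_ne h1 h2,
          ev_X, mul_assoc, L_mul_T_of_ne i j h1 h2, ← mul_assoc, hf, map_mul, map_mul, ev_X,
          add_mul, smul_mul_assoc, ← ev_X j, ev_mul_comm (dem i f), mul_assoc]

/-! ### The element `x_(r)` -/

theorem Tw_mul_T_of_lt {w : Equiv.Perm (Fin r)} {i : Fin (r - 1)} (h : w (lo i) < w (hi i)) :
    Tw q u w * T q u i = Tw q u (w * simpleRefl i) :=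
  prod_reducedWord_mul (T q u) T_braid T_comm h

theorem Tw_mul_T_of_gt {w : Equiv.Perm (Fin r)} {i : Fin (r - 1)} (h : w (hi i) < w (lo i)) :
    Tw q u w * T q u i = (q - 1) • Tw q u w + q • Tw q u (w * simpleRefl i) := by
  have h1 := Tw_mul_T_of_lt (q := q) (u := u) (w := w * simpleRefl i) (i := i) (by simpa using h)
  rw [mul_simpleRefl_mul_simpleRefl] at h1
  conv_lhs => rw [← h1]
  rw [mul_assoc, T_mul_self, mul_add, mul_smul_comm, mul_smul_comm, h1, mul_one]

/-- Pair each ascent `w` with `w s_i`: the sum `T_w + T_{w s_i}` is already an eigenvector of right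
multiplication by `T_i` with eigenvalue `q`. -/
theorem xRow_mul_T (i : Fin (r - 1)) : xRow q u r * T q u i = q • xRow q u r := by
  classical
  let asc : Equiv.Perm (Fin r) → Prop := fun w ↦ w (lo i) < w (hi i)
  have hdesc : ∀ g : Equiv.Perm (Fin r) → Hecke q u r,
      ∑ w with ¬ asc w, g w = ∑ w with asc w, g (w * simpleRefl i) := by
    intro g
    refine Finset.sum_bij' (fun w _ ↦ w * simpleRefl i) (fun w _ ↦ w * simpleRefl i) ?_ ?_ ?_ ?_ ?_
    · intro w hw
      have := (lt_or_gt_lo_hi w i).resolve_left (Finset.mem_filter.mp hw).2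
      simpa [asc] using this
    · intro w hw
      have := (Finset.mem_filter.mp hw).2
      simpa [asc] using this.le
    all_goals simp
  have hsplit : ∀ g : Equiv.Perm (Fin r) → Hecke q u r,
      ∑ w, g w = ∑ w with asc w, (g w + g (w * simpleRefl i)) := by
    intro g
    rw [← Finset.sum_filter_add_sum_filter_not _ asc, hdesc, Finset.sum_add_distrib]
  rw [xRow, Finset.sum_mul, hsplit, hsplit, Finset.smul_sum]
  refine Finset.sum_congr rfl fun w hw ↦ ?_
  have hw' : w (lo i) < w (hi i) := (Finset.mem_filter.mp hw).2
  rw [Tw_mul_T_of_lt hw', Tw_mul_T_of_gt (by simpa using hw'), mul_simpleRefl_mul_simpleRefl]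
  module

theorem xRow_mul_ev_mul_T (hq : IsUnit q) (i : Fin (r - 1)) (f : Poly R r) :
    xRow q u r * ev q u f * T q u i =
      xRow q u r * ev q u (q • polySwap i f + (q - 1) • dem i f) := by
  rw [mul_assoc, ev_mul_T hq, mul_add, ← mul_assoc, xRow_mul_T, map_add, map_smul, map_smul,
    mul_add, smul_mul_assoc, mul_smul_comm, mul_smul_comm]

/-- For symmetric `f` the correction term of the Bernstein relation vanishes, so `f(L)` commutes
with every `T_i`. -/
theorem ev_mul_xRow (hq : IsUnit q) {f : Poly R r} (hf : ∀ i, polySwap i f = f) :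
    ev q u f * xRow q u r = xRow q u r * ev q u f := by
  have hT : ∀ i, Commute (ev q u f) (T q u i) := fun i ↦ by
    rw [Commute, SemiconjBy, ev_mul_T hq, hf, dem_eq_zero (hf i), map_zero, smul_zero, add_zero]
  refine Commute.sum_right _ _ _ fun w _ ↦ Commute.list_prod_right _ _ fun y hy ↦ ?_
  obtain ⟨i, -, rfl⟩ := List.mem_map.mp hy
  exact hT i

theorem one_mem_trunc (hm : 1 ≤ m) : (1 : Poly R r) ∈ trunc R r m :=
  monomial_mem_box (fun _ ↦ hm) 1

/-- The span of `x_(r) L^b` with all exponents less than `m` is a right ideal. -/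
theorem exists_trunc_mul (hq : IsUnit q) (hm : 1 ≤ m) (h : Hecke q u r) :
    ∀ f ∈ trunc R r m, ∃ g ∈ trunc R r m, xRow q u r * ev q u f * h = xRow q u r * ev q u g := by
  have hT : ∀ i, ∀ f ∈ trunc R r m, ∃ g ∈ trunc R r m,
      xRow q u r * ev q u f * T q u i = xRow q u r * ev q u g := fun i f hf ↦
    ⟨_, Submodule.add_mem _ (Submodule.smul_mem _ _ (polySwap_mem_trunc hf i))
      (Submodule.smul_mem _ _ (dem_mem_trunc hf i)), xRow_mul_ev_mul_T hq i f⟩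
  induction h using Hecke.induction with
  | algebraMap c =>
    intro f hf
    refine ⟨c • f, Submodule.smul_mem _ _ hf, ?_⟩
    rw [map_smul, mul_smul_comm, ← Algebra.commutes, Algebra.smul_def]
  | T i => exact hT i
  | L j =>
    obtain ⟨n, hn⟩ := j
    induction n with
    | zero =>
      intro f hf
      refine ⟨cycMul u ⟨0, hn⟩ f, cycMul_mem_trunc u hm hf _, ?_⟩
      -- Reducing modulo the cyclotomic polynomial does not change the product, since that
      -- polynomial vanishes at `L_1`.
      rw [cycMul_apply, map_sub, map_mul _ (cyc u _), ev_cyc rfl, zero_mul, sub_zero, mul_comm,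
        map_mul, ev_X, mul_assoc]
    | succ n ih =>
      intro f hf
      obtain ⟨p, hp⟩ := hq.exists_left_inv
      let i : Fin (r - 1) := ⟨n, by omega⟩
      -- The later `L` are products of operators for which the claim is known, up to the inverse `p`
      -- of `q`.
      have hL : L q u ⟨n + 1, hn⟩ = p • (T q u i * L q u (lo i) * T q u i) := by
        rw [T_mul_L_mul_T, Algebra.algebraMap_eq_smul_one, smul_mul_assoc, one_mul, smul_smul, hp,
          one_smul]
        rfl
      obtain ⟨g1, hg1, e1⟩ := hT i f hf
      obtain ⟨g2, hg2, e2⟩ := ih (by omega) g1 hg1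
      obtain ⟨g3, hg3, e3⟩ := hT i g2 hg2
      refine ⟨p • g3, Submodule.smul_mem _ _ hg3, ?_⟩
      rw [hL, mul_smul_comm, map_smul, mul_smul_comm, ← e3, ← e2, ← e1]
      simp only [mul_assoc]
      rfl
  | add a b ha hb =>
    intro f hf
    obtain ⟨g1, hg1, e1⟩ := ha f hf
    obtain ⟨g2, hg2, e2⟩ := hb f hf
    exact ⟨g1 + g2, Submodule.add_mem _ hg1 hg2, by rw [mul_add, e1, e2, map_add, mul_add]⟩
  | mul a b ha hb =>
    intro f hf
    obtain ⟨g1, hg1, e1⟩ := ha f hf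
    obtain ⟨g2, hg2, e2⟩ := hb g1 hg1
    exact ⟨g2, hg2, by rw [← mul_assoc, e1, e2]⟩

theorem exists_trunc_of_xRow_mul (hq : IsUnit q) (hm : 1 ≤ m) (h : Hecke q u r) :
    ∃ g ∈ trunc R r m, xRow q u r * h = xRow q u r * ev q u g := by
  obtain ⟨g, hg, e⟩ := exists_trunc_mul hq hm h 1 (one_mem_trunc hm)
  exact ⟨g, hg, by rwa [map_one, mul_one] at e⟩

theorem sigma_eq_ev (k : ℕ) : sigma q u r k = ev q u (esymm (Fin r) R k) := by
  rw [sigma, esymm, map_sum]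
  refine Finset.sum_congr rfl fun S _ ↦ ?_
  have : (∏ i ∈ S, X i : Poly R r) = (S.sort.map X).prod := by
    conv_lhs => rw [Finset.prod, ← Finset.sort_eq S (· ≤ ·)]
    rw [Multiset.map_coe, Multiset.prod_coe]
  rw [this, map_list_prod, List.map_map]
  congr 2
  funext j
  exact (ev_X j).symm

theorem sigmaPow_eq_ev (a : Fin r → ℕ) :
    sigmaPow q u a = ev q u (∏ i : Fin r, esymm (Fin r) R (i + 1) ^ a i) := by
  rw [sigmaPow, ← List.prod_ofFn, map_list_prod, List.map_ofFn]
  congr 2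
  funext i
  rw [Function.comp_apply, map_pow, sigma_eq_ev]

end Evaluation

/-! ### The regular representation of the Hecke algebra of the symmetric group -/

section Regular

variable {R : Type*} [CommRing R] (q : R) {r : ℕ}

/-- Right multiplication by `T_i` in the Hecke algebra of the symmetric group, which has a basis
indexed by permutations. -/
noncomputable def regT (i : Fin (r - 1)) : Module.End R (Equiv.Perm (Fin r) →₀ R) :=
  Finsupp.linearCombination R fun w ↦ if w (lo i) < w (hi i) then
    Finsupp.single (w * simpleRefl i) 1
    else q • Finsupp.single (w * simpleRefl i) 1 + (q - 1) • Finsupp.single w 1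

variable {q}

theorem regT_single_of_lt {i : Fin (r - 1)} {w : Equiv.Perm (Fin r)} (h : w (lo i) < w (hi i)) :
    regT q i (Finsupp.single w 1) = Finsupp.single (w * simpleRefl i) 1 := by
  rw [regT, Finsupp.linearCombination_single, one_smul, if_pos h]

theorem regT_single_of_gt {i : Fin (r - 1)} {w : Equiv.Perm (Fin r)} (h : w (hi i) < w (lo i)) :
    regT q i (Finsupp.single w 1) =
      q • Finsupp.single (w * simpleRefl i) 1 + (q - 1) • Finsupp.single w 1 := by
  rw [regT, Finsupp.linearCombination_single, one_smul, if_neg h.not_gt]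

theorem regT_regT (i : Fin (r - 1)) (e : Equiv.Perm (Fin r) →₀ R) :
    regT q i (regT q i e) = (q - 1) • regT q i e + q • e := by
  have : regT q i ∘ₗ regT q i = (q - 1) • regT q i + q • LinearMap.id := by
    refine Finsupp.lhom_ext' fun w ↦ LinearMap.ext_ring ?_
    simp only [LinearMap.comp_apply, Finsupp.lsingle_apply, LinearMap.add_apply,
      LinearMap.smul_apply, LinearMap.id_apply]
    rcases lt_or_gt_lo_hi w i with h | h
    · rw [regT_single_of_lt h, regT_single_of_gt (by simpa using h), mul_simpleRefl_mul_simpleRefl,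
        add_comm]
    · rw [regT_single_of_gt h, map_add, map_smul, map_smul, regT_single_of_gt h,
        regT_single_of_lt (by simpa using h), mul_simpleRefl_mul_simpleRefl]
      module
  exact congrArg (fun φ ↦ φ e) this

theorem regT_comm {i j : Fin (r - 1)} (hij : (i : ℕ) + 1 < j) (e : Equiv.Perm (Fin r) →₀ R) :
    regT q i (regT q j e) = regT q j (regT q i e) := by
  have : regT q i ∘ₗ regT q j = regT q j ∘ₗ regT q i := by
    refine Finsupp.lhom_ext' fun w ↦ LinearMap.ext_ring ?_
    simp only [LinearMap.comp_apply, Finsupp.lsingle_apply]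
    have e1 : simpleRefl j (lo i) = lo i := simpleRefl_of_ne
      (by simp [lo, Fin.ext_iff]; omega) (by simp [lo, hi, Fin.ext_iff]; omega)
    have e2 : simpleRefl j (hi i) = hi i := simpleRefl_of_ne
      (by simp [lo, hi, Fin.ext_iff]; omega) (by simp [hi, Fin.ext_iff]; omega)
    have e3 : simpleRefl i (lo j) = lo j := simpleRefl_of_ne
      (by simp [lo, Fin.ext_iff]; omega) (by simp [lo, hi, Fin.ext_iff]; omega)
    have e4 : simpleRefl i (hi j) = hi j := simpleRefl_of_ne
      (by simp [lo, hi, Fin.ext_iff]; omega) (by simp [hi, Fin.ext_iff]; omega)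
    have hc : w * simpleRefl i * simpleRefl j = w * simpleRefl j * simpleRefl i := by
      rw [mul_assoc, simpleRefl_comm hij, mul_assoc]
    rcases lt_or_gt_lo_hi w i with h | h <;> rcases lt_or_gt_lo_hi w j with h' | h' <;>
      simp only [regT_single_of_lt, regT_single_of_gt, map_add, map_smul, Equiv.Perm.mul_apply, h,
        h', e1, e2, e3, e4, hc]
    module
  exact congrArg (fun φ ↦ φ e) this

theorem regT_braid {i j : Fin (r - 1)} (hij : (j : ℕ) = i + 1) (e : Equiv.Perm (Fin r) →₀ R) :
    regT q i (regT q j (regT q i e)) = regT q j (regT q i (regT q j e)) := by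
  have : regT q i ∘ₗ regT q j ∘ₗ regT q i = regT q j ∘ₗ regT q i ∘ₗ regT q j := by
    refine Finsupp.lhom_ext' fun w ↦ LinearMap.ext_ring ?_
    simp only [LinearMap.comp_apply, Finsupp.lsingle_apply]
    have e1 := simpleRefl_lo_of_succ hij
    have e2 := simpleRefl_hi_of_succ hij
    have e3 := lo_eq_hi hij
    have e4 : simpleRefl j (hi i) = hi j := by rw [← e3, simpleRefl_lo]
    have hb : w * simpleRefl j * simpleRefl i * simpleRefl j =
        w * simpleRefl i * simpleRefl j * simpleRefl i := by
      simpa only [mul_assoc] using congrArg (w * ·) (simpleRefl_braid hij).symm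
    have h1 := lt_or_gt_lo_hi w i
    have h2 : w (hi i) < w (hi j) ∨ w (hi j) < w (hi i) := by
      have := lt_or_gt_lo_hi w j
      rwa [e3] at this
    have h3 : w (lo i) < w (hi j) ∨ w (hi j) < w (lo i) :=
      lt_or_gt_of_ne (w.injective.ne (by simp [lo, hi, Fin.ext_iff]; omega))
    -- The action on `w` depends only on the relative order of three consecutive values; two of the
    -- eight sign patterns contradict transitivity.
    rcases h1 with h1 | h1 <;> rcases h2 with h2 | h2 <;> rcases h3 with h3 | h3 <;>
      first
      | exact absurd (h1.trans h2) h3.not_gt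
      | exact absurd (h2.trans h1) h3.not_gt
      | (simp only [regT_single_of_lt, regT_single_of_gt, map_add, map_smul, Equiv.Perm.mul_apply,
          simpleRefl_lo, simpleRefl_hi, mul_simpleRefl_mul_simpleRefl, h1, h2, h3, e1, e2, e3, e4,
          hb]
         try module)
  exact congrArg (fun φ ↦ φ e) this

end Regular

/-! ### Induced representations on `E ⊗ R[X_1, …, X_r]` -/

section Induced

open MvPolynomial
open scoped TensorProduct

variable {R : Type*} [CommRing R] (q : R) {r : ℕ} {E : Type*} [AddCommGroup E] [Module R E]
  (t : Fin (r - 1) → Module.End R E)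

/-- The action of `T_i` on the module induced from a module `E` of the Hecke algebra of the
symmetric group. -/
noncomputable def indT (i : Fin (r - 1)) : Module.End R (E ⊗[R] Poly R r) :=
  TensorProduct.map (t i) (polySwap i).toLinearMap + (q - 1) • LinearMap.lTensor E (dem i)

variable (R E) in
/-- The action of `X_j` on the induced module. -/
noncomputable def indX (j : Fin r) : Module.End R (E ⊗[R] Poly R r) :=
  LinearMap.lTensor E (LinearMap.mulLeft R (X j))

variable {q t}

theorem indT_tmul (i : Fin (r - 1)) (e : E) (f : Poly R r) :
    indT q t i (e ⊗ₜ f) = t i e ⊗ₜ polySwap i f + (q - 1) • (e ⊗ₜ dem i f) := rfl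

@[simp] theorem indX_tmul (j : Fin r) (e : E) (f : Poly R r) :
    indX R E j (e ⊗ₜ f) = e ⊗ₜ (X j * f) := rfl

theorem indT_tmul_one (i : Fin (r - 1)) (e : E) :
    indT q t i (e ⊗ₜ (1 : Poly R r)) = t i e ⊗ₜ 1 := by
  rw [indT_tmul, dem_one, TensorProduct.tmul_zero, smul_zero, add_zero, map_one]

theorem indT_indX_lo (i : Fin (r - 1)) (n : E ⊗[R] Poly R r) :
    indT q t i (indX R E (lo i) n) =
      indX R E (hi i) (indT q t i n) - (q - 1) • indX R E (hi i) n := by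
  induction n using TensorProduct.induction_on with
  | zero => simp
  | tmul e f =>
    simp only [indX_tmul, indT_tmul, map_add, map_smul, map_mul, polySwap_X, simpleRefl_lo,
      dem_X_lo_mul, TensorProduct.tmul_sub]
    module
  | add a b ha hb => simp only [map_add, ha, hb]; module

theorem indT_indX_hi (i : Fin (r - 1)) (n : E ⊗[R] Poly R r) :
    indT q t i (indX R E (hi i) n) =
      indX R E (lo i) (indT q t i n) + (q - 1) • indX R E (hi i) n := by
  induction n using TensorProduct.induction_on with
  | zero => simp
  | tmul e f =>
    simp only [indX_tmul, indT_tmul, map_add, map_smul, map_mul, polySwap_X, simpleRefl_hi,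
      dem_X_hi_mul, TensorProduct.tmul_add]
    module
  | add a b ha hb => simp only [map_add, ha, hb]; module

theorem indT_indX_of_ne {i : Fin (r - 1)} {j : Fin r} (h : j ≠ lo i) (h' : j ≠ hi i)
    (n : E ⊗[R] Poly R r) : indT q t i (indX R E j n) = indX R E j (indT q t i n) := by
  induction n using TensorProduct.induction_on with
  | zero => simp
  | tmul e f =>
    simp only [indX_tmul, indT_tmul, map_add, map_smul, map_mul, polySwap_X, simpleRefl_of_ne h h',
      dem_X_mul_of_ne h h']
  | add a b ha hb => simp only [map_add, ha, hb]

/-- An operator on the induced module that intertwines the variables up to a permutation is zero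
as soon as it vanishes on `E ⊗ 1`. -/
theorem eq_of_intertwines {φ ψ : Module.End R (E ⊗[R] Poly R r)}
    (h1 : ∀ e : E, φ (e ⊗ₜ 1) = ψ (e ⊗ₜ 1))
    (hX : ∀ j, ∃ j', ∀ n, φ (indX R E j n) - ψ (indX R E j n) = indX R E j' (φ n - ψ n)) :
    φ = ψ := by
  refine TensorProduct.ext' fun e f ↦ ?_
  induction f using MvPolynomial.induction_on with
  | C a =>
    have : e ⊗ₜ[R] (C a : Poly R r) = a • (e ⊗ₜ[R] (1 : Poly R r)) := by
      rw [← TensorProduct.tmul_smul, smul_eq_C_mul, mul_one]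
    rw [this, map_smul, map_smul, h1]
  | add f g hf hg => rw [TensorProduct.tmul_add, map_add, map_add, hf, hg]
  | mul_X f j hf =>
    obtain ⟨j', hj⟩ := hX j
    rw [mul_comm, ← indX_tmul, ← sub_eq_zero, hj, hf, sub_self, map_zero]

variable (quadratic : ∀ i e, t i (t i e) = (q - 1) • t i e + q • e)

include quadratic in
theorem indT_indT (i : Fin (r - 1)) (n : E ⊗[R] Poly R r) :
    indT q t i (indT q t i n) = (q - 1) • indT q t i n + q • n := by
  have : indT q t i ∘ₗ indT q t i = (q - 1) • indT q t i + q • LinearMap.id := by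
    -- Up to lower terms `T_i X_j` is `X_{s_i j} T_i`. A single word in the `T_i` need not
    -- intertwine the variables exactly, but the difference of the two sides of a relation does,
    -- with the index moved by the underlying permutation; here `s_i ^ 2 = 1`.
    refine eq_of_intertwines (fun e ↦ ?_) (fun j ↦ ⟨j, fun n ↦ ?_⟩)
    · simp only [LinearMap.comp_apply, LinearMap.add_apply, LinearMap.smul_apply, LinearMap.id_apply,
        indT_tmul_one, quadratic, TensorProduct.add_tmul, TensorProduct.smul_tmul']
    · simp only [LinearMap.comp_apply, LinearMap.add_apply, LinearMap.smul_apply, LinearMap.id_apply]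
      by_cases h : j = lo i
      · subst h
        simp only [indT_indX_lo, indT_indX_hi, map_sub, map_add, map_smul]
        module
      · by_cases h' : j = hi i
        · subst h'
          simp only [indT_indX_lo, indT_indX_hi, map_sub, map_add, map_smul]
          module
        · simp only [indT_indX_of_ne h h', map_sub, map_add, map_smul]
  exact congrArg (fun φ ↦ φ n) this

theorem indT_comm {i j : Fin (r - 1)} (hij : (i : ℕ) + 1 < j)
    (comm : ∀ e, t i (t j e) = t j (t i e)) (n : E ⊗[R] Poly R r) :
    indT q t i (indT q t j n) = indT q t j (indT q t i n) := by
  have : indT q t i ∘ₗ indT q t j = indT q t j ∘ₗ indT q t i := by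
    refine eq_of_intertwines (fun e ↦ ?_) (fun k ↦
      ⟨simpleRefl i (simpleRefl j k), fun n ↦ ?_⟩)
    · simp only [LinearMap.comp_apply, indT_tmul_one, comm]
    · have a1 : lo i ≠ lo j := by simp [lo, Fin.ext_iff]; omega
      have a2 : lo i ≠ hi j := by simp [lo, hi, Fin.ext_iff]; omega
      have a3 : hi i ≠ lo j := by simp [lo, hi, Fin.ext_iff]; omega
      have a4 : hi i ≠ hi j := by simp [hi, Fin.ext_iff]; omega
      simp only [LinearMap.comp_apply]
      by_cases h1 : k = lo i
      · subst h1
        simp only [simpleRefl_of_ne a1 a2, simpleRefl_lo, indT_indX_of_ne a1 a2,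
          indT_indX_of_ne a3 a4, indT_indX_lo, map_sub, map_smul]
        module
      by_cases h2 : k = hi i
      · subst h2
        simp only [simpleRefl_of_ne a3 a4, simpleRefl_hi, indT_indX_of_ne a1 a2,
          indT_indX_of_ne a3 a4, indT_indX_hi, map_add, map_smul, map_sub]
        module
      by_cases h3 : k = lo j
      · subst h3
        simp only [simpleRefl_lo, simpleRefl_of_ne a2.symm a4.symm, indT_indX_of_ne a2.symm a4.symm,
          indT_indX_of_ne a1.symm a3.symm, indT_indX_lo, map_sub, map_smul]
        module
      by_cases h4 : k = hi j
      · subst h4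
        simp only [simpleRefl_hi, simpleRefl_of_ne a1.symm a3.symm,
          indT_indX_of_ne a2.symm a4.symm, indT_indX_of_ne a1.symm a3.symm, indT_indX_hi, map_add,
          map_smul, map_sub]
        module
      · simp only [simpleRefl_of_ne h1 h2, simpleRefl_of_ne h3 h4, indT_indX_of_ne h1 h2,
          indT_indX_of_ne h3 h4, map_sub]
  exact congrArg (fun φ ↦ φ n) this

include quadratic in
theorem indT_braid {i j : Fin (r - 1)} (hij : (j : ℕ) = i + 1)
    (braid : ∀ e, t i (t j (t i e)) = t j (t i (t j e))) (n : E ⊗[R] Poly R r) :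
    indT q t i (indT q t j (indT q t i n)) = indT q t j (indT q t i (indT q t j n)) := by
  have : indT q t i ∘ₗ indT q t j ∘ₗ indT q t i = indT q t j ∘ₗ indT q t i ∘ₗ indT q t j := by
    -- The variables are permuted by `s_i s_j s_i`, the permutation underlying both sides of the
    -- braid relation.
    refine eq_of_intertwines (fun e ↦ ?_) (fun k ↦
      ⟨simpleRefl i (simpleRefl j (simpleRefl i k)), fun n ↦ ?_⟩)
    · simp only [LinearMap.comp_apply, indT_tmul_one, braid]
    · have e1 := lo_eq_hi hij
      have a1 : lo i ≠ lo j := by simp [lo, Fin.ext_iff]; omega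
      have a2 : lo i ≠ hi j := by simp [lo, hi, Fin.ext_iff]; omega
      have a4 : hi j ≠ hi i := by simp [hi, Fin.ext_iff]; omega
      have b1 (n) : indT q t j (indX R E (hi i) n) =
          indX R E (hi j) (indT q t j n) - (q - 1) • indX R E (hi j) n := by
        rw [← e1, indT_indX_lo]
      have b2 (n) : indT q t j (indX R E (hi j) n) =
          indX R E (hi i) (indT q t j n) + (q - 1) • indX R E (hi j) n := by
        rw [← e1, indT_indX_hi]
      have c1 : simpleRefl j (hi i) = hi j := by rw [← e1, simpleRefl_lo]
      have c2 : simpleRefl j (hi j) = hi i := by rw [← e1, simpleRefl_hi]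
      simp only [LinearMap.comp_apply]
      by_cases h1 : k = lo i
      · subst h1
        simp only [simpleRefl_lo, c1, simpleRefl_hi_of_succ hij, indT_indX_lo, b1,
          indT_indX_of_ne a2.symm a4, indT_indX_of_ne a1 a2, map_sub, map_smul, map_add,
          indT_indT quadratic]
        module
      by_cases h2 : k = hi i
      · subst h2
        simp only [simpleRefl_lo, simpleRefl_hi, simpleRefl_lo_of_succ hij, indT_indX_lo,
          indT_indX_hi, b1, b2, indT_indX_of_ne a2.symm a4, indT_indX_of_ne a1 a2, map_sub,
          map_smul, map_add]
        module
      by_cases h3 : k = hi j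
      · subst h3
        simp only [simpleRefl_hi, simpleRefl_hi_of_succ hij, c2, indT_indX_hi, b1, b2, indT_indX_of_ne a2.symm a4, indT_indX_of_ne a1 a2, map_sub,
          map_smul, map_add, indT_indT quadratic]
        module
      · have h4 : k ≠ lo j := e1 ▸ h2
        simp only [simpleRefl_of_ne h1 h2, simpleRefl_of_ne h4 h3, indT_indX_of_ne h1 h2,
          indT_indX_of_ne h4 h3, map_sub]
  exact congrArg (fun φ ↦ φ n) this

include quadratic in
/-- The operator `T_i X_i T_i` is `q X_{i+1}`. -/
theorem indT_indX_indT (i : Fin (r - 1)) (n : E ⊗[R] Poly R r) :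
    indT q t i (indX R E (lo i) (indT q t i n)) = q • indX R E (hi i) n := by
  rw [indT_indX_lo, indT_indT quadratic, map_add, map_smul, map_smul]
  module

end Induced

/-! ### Induced representations of the cyclotomic Hecke algebra -/

section Truncated

open MvPolynomial
open scoped TensorProduct

variable {R : Type*} [CommRing R] (q : R) {m : ℕ} (u : Fin m → R) {r : ℕ}
  {E : Type*} [AddCommGroup E] [Module R E] (t : Fin (r - 1) → Module.End R E)

variable (R m r E) in
/-- The inclusion of `E ⊗ trunc` into `E ⊗ R[X_1, …, X_r]`. -/
noncomputable def truncIncl : E ⊗[R] trunc R r m →ₗ[R] E ⊗[R] Poly R r :=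
  LinearMap.lTensor E (trunc R r m).subtype

/-- Flatness allows relations on `E ⊗ trunc` to be checked in `E ⊗ R[X_1, …, X_r]`, where the
operators have explicit formulas. -/
theorem truncIncl_injective [Module.Flat R E] : Function.Injective (truncIncl R m r E) :=
  Module.Flat.lTensor_preserves_injective_linearMap _ (Submodule.subtype_injective _)

@[simp] theorem truncIncl_tmul (e : E) (f : trunc R r m) :
    truncIncl R m r E (e ⊗ₜ f) = e ⊗ₜ f.1 := rfl

/-- The action of `T_i` on `E ⊗ trunc`. -/
noncomputable def truncT (i : Fin (r - 1)) : Module.End R (E ⊗[R] trunc R r m) :=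
  TensorProduct.map (t i) ((polySwap i).toLinearMap.restrict fun _ h ↦ polySwap_mem_trunc h i) +
    (q - 1) • LinearMap.lTensor E ((dem i).restrict fun _ h ↦ dem_mem_trunc h i)

variable (E) in
/-- The action of `X_a` modulo the cyclotomic polynomial on `E ⊗ trunc`. -/
noncomputable def truncL (hm : 1 ≤ m) (a : Fin r) : Module.End R (E ⊗[R] trunc R r m) :=
  LinearMap.lTensor E ((cycMul u a).restrict fun _ h ↦ cycMul_mem_trunc u hm h a)

variable {q u t}

theorem truncIncl_truncT (i : Fin (r - 1)) (n : E ⊗[R] trunc R r m) :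
    truncIncl R m r E (truncT q t i n) = indT q t i (truncIncl R m r E n) := by
  induction n using TensorProduct.induction_on with
  | zero => simp
  | tmul e f => simp only [truncT, LinearMap.add_apply, LinearMap.smul_apply, map_add, map_smul]; rfl
  | add a b ha hb => simp only [map_add, ha, hb]

theorem truncIncl_truncL (hm : 1 ≤ m) (a : Fin r) (n : E ⊗[R] trunc R r m) :
    truncIncl R m r E (truncL u E hm a n) =
      LinearMap.lTensor E (cycMul u a) (truncIncl R m r E n) := by
  induction n using TensorProduct.induction_on with
  | zero => simp
  | tmul e f => rfl
  | add a b ha hb => simp only [map_add, ha, hb]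

theorem truncL_tmul (hm : 1 ≤ m) (a : Fin r) (e : E) (f : trunc R r m) :
    truncL u E hm a (e ⊗ₜ f) = e ⊗ₜ ⟨cycMul u a f.1, cycMul_mem_trunc u hm f.2 a⟩ := rfl

theorem indT_cycMul_of_ne {i : Fin (r - 1)} {a : Fin r} (h : a ≠ lo i) (h' : a ≠ hi i)
    (n : E ⊗[R] Poly R r) :
    indT q t i (LinearMap.lTensor E (cycMul u a) n) =
      LinearMap.lTensor E (cycMul u a) (indT q t i n) := by
  induction n using TensorProduct.induction_on with
  | zero => simp
  | tmul e f =>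
    simp only [LinearMap.lTensor_tmul, indT_tmul, map_add, map_smul, polySwap_cycMul_of_ne u h h',
      dem_cycMul_of_ne u h h']
  | add a b ha hb => simp only [map_add, ha, hb]

section Quadratic

variable (quadratic : ∀ i e, t i (t i e) = (q - 1) • t i e + q • e)

include quadratic

/-- Expanding and using the quadratic relation for `t i` sorts the terms into a `(q - 1)` part and a
`q` part; each commutes with `cycMul` for its own reason. -/
theorem indT_cycMul_indT (i : Fin (r - 1)) (e : E) {f : Poly R r} (hf : f ∈ trunc R r m) :
    indT q t i (LinearMap.lTensor E (cycMul u (lo i)) (indT q t i (e ⊗ₜ f))) =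
      (q - 1) • (t i e ⊗ₜ (polySwap i (cycMul u (lo i) (polySwap i f)) +
        dem i (cycMul u (lo i) (polySwap i f)) + polySwap i (cycMul u (lo i) (dem i f)))) +
      q • (e ⊗ₜ polySwap i (cycMul u (lo i) (polySwap i f))) := by
  simp only [indT_tmul, map_add, map_smul, LinearMap.lTensor_tmul, dem_cycMul_dem u hf, quadratic,
    TensorProduct.tmul_add, TensorProduct.add_tmul, ← TensorProduct.smul_tmul', TensorProduct.tmul_zero]
  module

/-- The `(q - 1)` part is `reflection_coeff_comm`; in the `q` part the swap turns `cycMul` at `X_i`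
into `cycMul` at `X_{i+1}`, and these two commute. -/
theorem truncL_reflection [Module.Flat R E] (hm : 1 ≤ m) (i : Fin (r - 1))
    (n : E ⊗[R] trunc R r m) :
    truncL u E hm (lo i) (truncT q t i (truncL u E hm (lo i) (truncT q t i n))) =
      truncT q t i (truncL u E hm (lo i) (truncT q t i (truncL u E hm (lo i) n))) := by
  apply truncIncl_injective
  simp only [truncIncl_truncT, truncIncl_truncL]
  induction n using TensorProduct.induction_on with
  | zero => simp
  | tmul e f =>
    rw [truncIncl_tmul, indT_cycMul_indT quadratic i e f.2, LinearMap.lTensor_tmul,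
      indT_cycMul_indT quadratic i e (cycMul_mem_trunc u hm f.2 _)]
    simp only [map_add, map_smul, LinearMap.lTensor_tmul]
    rw [← map_add, ← map_add, reflection_coeff_comm u hm f.2, polySwap_cycMul_polySwap,
      polySwap_cycMul_polySwap, simpleRefl_lo, cycMul_comm u (lo_ne_hi i)]
  | add a b ha hb => simp only [map_add, ha, hb]

end Quadratic

/-! ### The cyclotomic relation for the truncated action. -/

theorem cyc_mul_mem_box {l : ℕ} (v : Fin l → R) {a : Fin r} {d d' : Fin r → ℕ} {g : Poly R r}
    (hg : g ∈ box R d) (h : ∀ j, j ≠ a → d j ≤ d' j) (h' : d a + l ≤ d' a) :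
    cyc v a * g ∈ box R d' := by
  obtain ⟨c, hc⟩ := cyc_expand v a
  rw [hc, add_mul, Finset.sum_mul]
  refine Submodule.add_mem _ (X_pow_mul_mem_box hg a l h h') (Submodule.sum_mem _ fun j hj ↦ ?_)
  rw [mul_assoc, C_mul']
  have := Finset.mem_range.mp hj
  exact Submodule.smul_mem _ _ (X_pow_mul_mem_box hg a j h (by omega))

/-- Fewer than `m` factors applied to a polynomial free of `X_a` never reach exponent `m`, so no
reduction takes place. -/
theorem prod_cycMul_sub {l : ℕ} (hl : l < m) (v : Fin l → R) {a : Fin r} {g : Poly R r}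
    (hg : g ∈ box R (Function.update (fun _ ↦ m) a 1)) :
    (List.ofFn fun k ↦ cycMul u a - algebraMap R (Module.End R (Poly R r)) (v k)).prod g =
      cyc v a * g := by
  induction l with
  | zero => simp [cyc]
  | succ l ih =>
    have hmem : cyc (fun k ↦ v (Fin.succ k)) a * g ∈ box R (Function.update (fun _ ↦ m) a (l + 1)) :=
      cyc_mul_mem_box _ hg (fun j hj ↦ by simp [hj]) (by simp; omega)
    rw [List.ofFn_succ, List.prod_cons, Module.End.mul_apply, ih (by omega) fun k ↦ v k.succ,
      LinearMap.sub_apply, cycMul_eq_X_mul u (by simp; omega) hmem, Module.algebraMap_end_apply,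
      cyc, cyc, Fin.prod_univ_succ, smul_eq_C_mul]
    ring

theorem coeffAt_cyc_mul_self {l : ℕ} (v : Fin l → R) {a : Fin r} {d : Fin r → ℕ} (hd : d a ≤ 1)
    {g : Poly R r} (hg : g ∈ box R d) : coeffAt a l (cyc v a * g) = g := by
  obtain ⟨c, hc⟩ := cyc_expand v a
  rw [hc, add_mul, Finset.sum_mul, map_add, map_sum, coeffAt_X_pow_mul l hd hg,
    Finset.sum_eq_zero fun j hj ↦ ?_, add_zero]
  have := Finset.mem_range.mp hj
  rw [mul_assoc, C_mul', map_smul, coeffAt_eq_zero (d := Function.update d a l) (by simp)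
    (X_pow_mul_mem_box hg a j (fun b hb ↦ by simp [hb]) (by simp; omega)), smul_zero]

/-- A truncated monomial is a power of `cycMul` applied to some `g` free of `X_a`, and the product
commutes with that power. On `g` all factors but one multiply honestly to a polynomial with top
coefficient `g` at `X_a ^ (m - 1)`; the remaining factor produces the full cyclotomic polynomial
times `g`, which the reduction subtracts. -/
theorem prod_cycMul_sub_eq_zero {a : Fin r} {f : Poly R r} (hf : f ∈ trunc R r m) :
    (List.ofFn fun k ↦ cycMul u a - algebraMap R (Module.End R (Poly R r)) (u k)).prod f = 0 := by
  refine box_induction (W := LinearMap.ker (List.ofFn fun k ↦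
    cycMul u a - algebraMap R (Module.End R (Poly R r)) (u k)).prod) (fun s hs ↦ ?_) hf
  rw [LinearMap.mem_ker]
  have hg : (monomial (s.erase a) 1 : Poly R r) ∈ box R (Function.update (fun _ ↦ m) a 1) :=
    monomial_mem_box (fun j ↦ by
      by_cases hj : j = a
      · subst hj; simp
      · simpa [hj, Finsupp.erase_ne hj] using hs j) 1
  set g : Poly R r := monomial (s.erase a) 1
  have hpow : ∀ k < m, (cycMul u a ^ k) g = X a ^ k * g := by
    intro k hk
    induction k with
    | zero => simp
    | succ k ih =>
      have hmem : X a ^ k * g ∈ box R (Function.update (fun _ ↦ m) a (k + 1)) :=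
        X_pow_mul_mem_box hg _ _ (fun j hj ↦ by simp [hj]) (by simp; omega)
      rw [pow_succ', Module.End.mul_apply, ih (by omega), cycMul_eq_X_mul u (by simp; omega) hmem,
        pow_succ', mul_assoc]
  have hs1 : (monomial s 1 : Poly R r) = (cycMul u a ^ s a) g := by
    rw [hpow _ (hs a), X_pow_eq_monomial, monomial_mul, one_mul, Finsupp.single_add_erase]
  have hcomm : Commute (List.ofFn fun k ↦ cycMul u a -
      algebraMap R (Module.End R (Poly R r)) (u k)).prod (cycMul u a ^ s a) := by
    refine Commute.pow_right (Commute.list_prod_left _ _ fun y hy ↦ ?_) _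
    obtain ⟨k, rfl⟩ := List.mem_ofFn.mp hy
    exact (Commute.refl _).sub_left (Algebra.commutes _ _)
  rw [hs1, ← Module.End.mul_apply, hcomm.eq, Module.End.mul_apply]
  obtain _ | l := m
  · exact absurd (hs a) (Nat.not_lt_zero _)
  have hmem : cyc (fun k ↦ u (Fin.succ k)) a * g ∈ trunc R r (l + 1) :=
    cyc_mul_mem_box _ hg (fun j hj ↦ by simp [hj]) (by simp; omega)
  have h0 : cycMul u a (cyc (fun k ↦ u (Fin.succ k)) a * g) -
      u 0 • (cyc (fun k ↦ u (Fin.succ k)) a * g) = 0 := by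
    rw [cycMul_apply, Nat.add_sub_cancel, coeffAt_cyc_mul_self _ (by simp) hg, cyc, cyc,
      Fin.prod_univ_succ, smul_eq_C_mul]
    ring
  rw [List.ofFn_succ, List.prod_cons, Module.End.mul_apply,
    prod_cycMul_sub (Nat.lt_succ_self l) (fun k ↦ u k.succ) hg, LinearMap.sub_apply,
    Module.algebraMap_end_apply, h0, map_zero]

theorem truncL_cyclotomic (hm : 1 ≤ m) (a : Fin r) :
    (List.ofFn fun k ↦ truncL u E hm a -
      algebraMap R (Module.End R (E ⊗[R] trunc R r m)) (u k)).prod = 0 := by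
  set c : Module.End R (trunc R r m) :=
    (cycMul u a).restrict fun _ h ↦ cycMul_mem_trunc u hm h a with hc
  let φ := Module.End.lTensorAlgHom R (trunc R r m) E
  have h1 : (List.ofFn fun k ↦ truncL u E hm a -
      algebraMap R (Module.End R (E ⊗[R] trunc R r m)) (u k)).prod =
      φ (List.ofFn fun k ↦ c - algebraMap R (Module.End R (trunc R r m)) (u k)).prod := by
    rw [map_list_prod, List.map_ofFn]
    refine congrArg (fun l ↦ (List.ofFn l).prod) (funext fun k ↦ ?_)
    exact (congrArg (truncL u E hm a - ·) (AlgHom.commutes φ (u k)).symm).trans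
      (LinearMap.lTensor_sub c _).symm
  have key : ∀ (l : List R) (f : trunc R r m),
      ((l.map fun x ↦ c - algebraMap R (Module.End R (trunc R r m)) x).prod f : Poly R r) =
        (l.map fun x ↦ cycMul u a - algebraMap R (Module.End R (Poly R r)) x).prod f.1 := by
    intro l
    induction l with
    | nil => intro f; rfl
    | cons x l ih =>
      intro f
      simp only [List.map_cons, List.prod_cons, Module.End.mul_apply, LinearMap.sub_apply,
        Module.algebraMap_end_apply, ← ih]
      rfl
  have h2 : (List.ofFn fun k ↦ c - algebraMap R (Module.End R (trunc R r m)) (u k)).prod = 0 := by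
    refine LinearMap.ext fun f ↦ Subtype.ext ?_
    have := key (List.ofFn u) f
    rw [List.map_ofFn, List.map_ofFn] at this
    exact this.trans (prod_cycMul_sub_eq_zero f.2)
  rw [h1, h2, map_zero]

variable {p : R}

/-- A module of the Hecke algebra of the symmetric group induces one of the cyclotomic Hecke
algebra. -/
theorem exists_truncRep [Module.Flat R E] (hm : 1 ≤ m) (hpq : q * p = 1)
    (quadratic : ∀ i e, t i (t i e) = (q - 1) • t i e + q • e)
    (braid : ∀ i j : Fin (r - 1), (j : ℕ) = i + 1 → ∀ e, t i (t j (t i e)) = t j (t i (t j e)))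
    (comm : ∀ i j : Fin (r - 1), (i : ℕ) + 1 < j → ∀ e, t i (t j e) = t j (t i e)) :
    ∃ φ : Hecke q u r →ₐ[R] Module.End R (E ⊗[R] trunc R r m),
      (∀ i, φ (T q u i) = truncT q t i) ∧ ∀ j : Fin r, φ (L q u j) =
        jucysMurphy p (truncT q t) (if h : 0 < r then truncL u E hm ⟨0, h⟩ else 0) j := by
  refine exists_algHom_of_typeB (fun i j hij ↦ ?_) (fun i j hij ↦ ?_) (fun i hi' ↦ ?_)
    (fun i hi' ↦ ?_) hpq (fun i ↦ ?_) (fun hr ↦ ?_)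
  · refine LinearMap.ext fun n ↦ truncIncl_injective ?_
    simp only [Module.End.mul_apply, truncIncl_truncT]
    exact indT_braid quadratic hij (braid i j hij) _
  · refine LinearMap.ext fun n ↦ truncIncl_injective ?_
    simp only [Module.End.mul_apply, truncIncl_truncT]
    exact indT_comm hij (comm i j hij) _
  · have hr : 0 < r := by have := i.2; omega
    rw [dif_pos hr]
    refine LinearMap.ext fun n ↦ truncIncl_injective ?_
    simp only [Module.End.mul_apply, truncIncl_truncT, truncIncl_truncL]
    refine (indT_cycMul_of_ne ?_ ?_ _).symm <;> simp only [lo, hi, ne_eq, Fin.mk.injEq] <;> omega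
  · have hr : 0 < r := by have := i.2; omega
    have h0 : (⟨0, hr⟩ : Fin r) = lo i := by simp [lo, hi']
    rw [dif_pos hr, h0]
    refine LinearMap.ext fun n ↦ ?_
    simp only [Module.End.mul_apply]
    exact truncL_reflection quadratic hm i n
  · refine LinearMap.ext fun n ↦ truncIncl_injective ?_
    simp only [Module.End.mul_apply, LinearMap.add_apply, LinearMap.sub_apply, Module.End.one_apply,
      Module.algebraMap_end_apply, LinearMap.zero_apply, map_add, map_sub, map_smul,
      truncIncl_truncT, map_zero, indT_indT quadratic]
    module
  · rw [dif_pos hr]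
    exact truncL_cyclotomic hm _

/-- On polynomials of small degree in `X_j`, the element `L_j` acts as multiplication by `X_j`. -/
theorem jucysMurphy_truncT [Module.Flat R E] (hm : 1 ≤ m) (hpq : q * p = 1)
    (quadratic : ∀ i e, t i (t i e) = (q - 1) • t i e + q • e) (hr : 0 < r) (j : ℕ) (hj : j < r)
    (e : E) (f : trunc R r m) (hf : f.1 ∈ box R (Function.update (fun _ ↦ m) ⟨j, hj⟩ (m - 1))) :
    truncIncl R m r E (jucysMurphy p (truncT q t) (truncL u E hm ⟨0, hr⟩) j (e ⊗ₜ f)) =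
      e ⊗ₜ (X ⟨j, hj⟩ * f.1) := by
  induction j generalizing e f with
  | zero =>
    rw [jucysMurphy, truncL_tmul, truncIncl_tmul]
    exact congrArg (e ⊗ₜ[R] ·) (cycMul_eq_X_mul u (by simp) hf)
  | succ j ih =>
    let i : Fin (r - 1) := ⟨j, by omega⟩
    have hlo : (⟨j, by omega⟩ : Fin r) = lo i := rfl
    have hhi : (⟨j + 1, hj⟩ : Fin r) = hi i := rfl
    rw [hhi] at hf ⊢
    have hs : polySwap i f.1 ∈ box R (Function.update (fun _ ↦ m) (lo i) (m - 1)) := by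
      refine polySwap_mem_box hf i fun k ↦ ?_
      by_cases hk : k = lo i
      · subst hk; simp
      · simp only [Function.update_apply, hk, if_false]
        split_ifs <;> omega
    have h1 := ih (by omega) (t i e) ⟨polySwap i f.1, polySwap_mem_trunc f.2 i⟩ hs
    have h2 := ih (by omega) e ⟨dem i f.1, dem_mem_trunc f.2 i⟩ (dem_mem_box_update f.2 i)
    have h3 : truncT q t i (e ⊗ₜ f) =
        t i e ⊗ₜ (⟨polySwap i f.1, polySwap_mem_trunc f.2 i⟩ : trunc R r m) +
        (q - 1) • (e ⊗ₜ (⟨dem i f.1, dem_mem_trunc f.2 i⟩ : trunc R r m)) := rfl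
    have h4 : jucysMurphy p (truncT q t) (truncL u E hm ⟨0, hr⟩) (j + 1) = p • (truncT q t i *
      jucysMurphy p (truncT q t) (truncL u E hm ⟨0, hr⟩) j * truncT q t i) := jucysMurphy_succ i
    rw [hlo] at h1 h2
    -- Both components of `T_i (e ⊗ f)` leave room for one more `X_i`: the swap moves the bound on
    -- `X_{i+1}` to `X_i`, and `D_i` lowers the exponent of `X_i`. Hence the untruncated identity
    -- `T_i X_i T_i = q X_{i+1}` applies.
    have h5 : truncIncl R m r E (jucysMurphy p (truncT q t) (truncL u E hm ⟨0, hr⟩) j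
        (truncT q t i (e ⊗ₜ f))) = indX R E (lo i) (indT q t i (e ⊗ₜ f.1)) := by
      rw [h3, map_add, map_add, map_smul, map_smul, h1, h2, indT_tmul, map_add, map_smul]
      rfl
    rw [h4, LinearMap.smul_apply, map_smul, Module.End.mul_apply, Module.End.mul_apply,
      truncIncl_truncT, h5, indT_indX_indT quadratic, smul_smul, mul_comm p q, hpq, one_smul,
      indX_tmul]

/-- The orbit of `E ⊗ 1` under polynomials in the Jucys--Murphy elements. -/
theorem truncRep_ev [Module.Flat R E] (hm : 1 ≤ m) (hpq : q * p = 1)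
    (quadratic : ∀ i e, t i (t i e) = (q - 1) • t i e + q • e)
    {φ : Hecke q u r →ₐ[R] Module.End R (E ⊗[R] trunc R r m)}
    (hφ : ∀ j : Fin r, φ (L q u j) =
        jucysMurphy p (truncT q t) (if h : 0 < r then truncL u E hm ⟨0, h⟩ else 0) j)
    (e : E) (f : trunc R r m) : φ (ev q u f.1) (e ⊗ₜ ⟨1, one_mem_trunc hm⟩) = e ⊗ₜ f := by
  apply truncIncl_injective
  obtain ⟨f, hf⟩ := f
  let ψ : Poly R r →ₗ[R] E ⊗[R] Poly R r :=
    truncIncl R m r E ∘ₗ LinearMap.applyₗ (e ⊗ₜ[R] (⟨1, one_mem_trunc hm⟩ : trunc R r m)) ∘ₗ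
      φ.toLinearMap ∘ₗ (ev q u).toLinearMap
  refine box_induction (W := LinearMap.eqLocus ψ (TensorProduct.mk R E (Poly R r) e))
    (fun s hs ↦ ?_) hf
  rw [LinearMap.mem_eqLocus]
  change truncIncl R m r E (φ (ev q u (monomial s 1)) (e ⊗ₜ ⟨1, one_mem_trunc hm⟩)) =
    e ⊗ₜ monomial s 1
  induction hn : s.degree generalizing s with
  | zero =>
    obtain rfl : s = 0 := (Finsupp.degree_eq_zero_iff s).mp hn
    change truncIncl R m r E (φ (ev q u 1) _) = _
    rw [map_one, map_one]
    rfl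
  | succ n ih =>
    have hne : s ≠ 0 := by rintro rfl; simp at hn
    obtain ⟨j, hj⟩ := Finsupp.ne_iff.mp hne
    obtain ⟨s', rfl⟩ : ∃ s', s = Finsupp.single j 1 + s' :=
      exists_add_of_le (by simpa using Nat.one_le_iff_ne_zero.mpr hj)
    -- After removing one `X_j`, the exponent of `X_j` is less than `m - 1`, so `L_j` puts it back
    -- without reduction.
    have hs' : ∀ k, s' k < Function.update (fun _ ↦ m) j (m - 1) k := fun k ↦ by
      have := hs k
      by_cases hk : k = j
      · subst hk; simp at this ⊢; omega
      · simpa [hk] using this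
    have hs2 : ∀ k, s' k < m := fun k ↦ (Nat.le_add_left _ _).trans_lt (hs k)
    have h1 := ih s' hs2 (by simp at hn; omega)
    have h2 : φ (ev q u (monomial s' 1)) (e ⊗ₜ ⟨1, one_mem_trunc hm⟩) =
        e ⊗ₜ ⟨monomial s' 1, monomial_mem_box hs2 1⟩ := truncIncl_injective h1
    have h3 : (monomial (Finsupp.single j 1 + s') (1 : R) : Poly R r) = X j * monomial s' 1 := by
      rw [X, monomial_mul, one_mul]
    rw [h3, map_mul, map_mul, Module.End.mul_apply, h2, ev_X, hφ, dif_pos j.pos]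
    exact jucysMurphy_truncT hm hpq quadratic j.pos j j.2 e _ (monomial_mem_box hs' 1)

end Truncated

/-! ### Independence of the elements `x_(r) L^b` -/

section Independence

open MvPolynomial MulOpposite
open scoped TensorProduct

variable {R : Type*} [CommRing R] {q : R} {m : ℕ} {u : Fin m → R} {r : ℕ}

/-- The anti-automorphism of the cyclotomic Hecke algebra that fixes all generators. -/
theorem exists_antiHom : ∃ ρ : Hecke q u r →ₐ[R] (Hecke q u r)ᵐᵒᵖ,
    (∀ i, ρ (T q u i) = op (T q u i)) ∧ ∀ j, ρ (L q u j) = op (L q u j) := by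
  have hqop : algebraMap R (Hecke q u r)ᵐᵒᵖ q = op (algebraMap R (Hecke q u r) q) := rfl
  refine exists_algHom _ _ (fun i ↦ unop_injective ?_) (fun i j h ↦ unop_injective ?_)
    (fun i j h ↦ unop_injective ?_) (fun i j ↦ unop_injective ?_) (fun j h ↦ unop_injective ?_)
    (fun i ↦ unop_injective ?_) (fun i j h h' ↦ unop_injective ?_)
  · change (T q u i - algebraMap R _ q) * (T q u i + 1) = 0
    rw [← T_quadratic (q := q) (u := u) i, sub_mul, add_mul, mul_add, mul_sub,
      ← Algebra.commutes q]
    simp only [mul_one, one_mul, mul_add]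
    abel
  · simpa only [unop_mul, unop_op, mul_assoc] using T_braid i j h
  · simpa only [unop_mul, unop_op] using (T_comm i j h).symm
  · simpa only [unop_mul, unop_op] using L_comm j i
  · rw [unop_list_prod, List.map_ofFn, unop_zero, ← L_cyclotomic (q := q) (u := u) j h]
    refine List.Perm.prod_eq' (List.reverse_perm _) ?_
    rw [List.pairwise_reverse, List.pairwise_ofFn]
    intro k l _
    exact ((Commute.refl (L q u j)).sub_left (Algebra.commutes _ _)).sub_right
      (Algebra.commutes _ _).symm
  · rw [hqop, ← op_mul, ← op_mul, ← op_mul, unop_op, unop_op, ← mul_assoc, T_mul_L_mul_T,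
      Algebra.commutes]
  · simpa only [unop_mul, unop_op] using (L_mul_T_of_ne i j h h').symm

theorem unop_antiHom_ev {ρ : Hecke q u r →ₐ[R] (Hecke q u r)ᵐᵒᵖ}
    (hρ : ∀ j, ρ (L q u j) = op (L q u j)) (f : Poly R r) :
    unop (ρ (ev q u f)) = ev q u f := by
  induction f using MvPolynomial.induction_on with
  | C a => rw [← MvPolynomial.algebraMap_eq, AlgHom.commutes, AlgHom.commutes]; rfl
  | add f g hf hg => rw [map_add, map_add, unop_add, hf, hg]
  | mul_X f j hf =>
    rw [map_mul, map_mul, unop_mul, hf, ev_X, hρ, unop_op, ← ev_X, ev_mul_comm]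

theorem truncT_tmul_one {E : Type*} [AddCommGroup E] [Module R E] [Module.Flat R E]
    {t : Fin (r - 1) → Module.End R E} (hm : 1 ≤ m) (i : Fin (r - 1)) (e : E) :
    truncT q t i (e ⊗ₜ (⟨1, one_mem_trunc hm⟩ : trunc R r m)) =
      t i e ⊗ₜ ⟨1, one_mem_trunc hm⟩ := by
  apply truncIncl_injective
  rw [truncIncl_truncT]
  exact indT_tmul_one i e

/-- The elements `x_(r) L^b` with all exponents less than `m` are linearly independent. -/
theorem eq_zero_of_xRow_mul_ev (hq : IsUnit q) (hm : 1 ≤ m) {f : Poly R r} (hf : f ∈ trunc R r m)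
    (h : xRow q u r * ev q u f = 0) : f = 0 := by
  obtain ⟨p, hpq⟩ := hq.exists_right_inv
  obtain ⟨φ, hφT, hφL⟩ := exists_truncRep (u := u) (t := regT q (r := r)) hm hpq regT_regT
    (fun i j hij ↦ regT_braid hij) (fun i j hij ↦ regT_comm hij)
  -- `regT` is right multiplication while `φ` is a left action, so words must be reversed. The
  -- reversal also lets `x` act on the generating vector before `f(L)` does.
  obtain ⟨ρ, hρT, hρL⟩ := exists_antiHom (q := q) (u := u) (r := r)
  let one : trunc R r m := ⟨1, one_mem_trunc hm⟩
  let g : Equiv.Perm (Fin r) → (Equiv.Perm (Fin r) →₀ R) ⊗[R] trunc R r m :=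
    fun w ↦ Finsupp.single w 1 ⊗ₜ one
  have hword : ∀ (l : List (Fin (r - 1))) n, φ (unop (ρ (l.map (T q u)).prod)) n =
      l.foldl (fun n i ↦ truncT q (regT q) i n) n := by
    intro l
    induction l with
    | nil => intro n; simp
    | cons i l ih =>
      intro n
      rw [List.map_cons, List.prod_cons, map_mul, unop_mul, map_mul, Module.End.mul_apply, hρT,
        unop_op, hφT, ih, List.foldl_cons]
  have hTw : ∀ w, φ (unop (ρ (Tw q u w))) (g 1) = g w := by
    intro w
    rw [Tw, hword, foldl_reducedWord g _ (fun w i hw ↦ ?_) _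
      (by rw [reducedWord_prod, reducedWord_length]), reducedWord_prod]
    rw [truncT_tmul_one hm, regT_single_of_lt hw]
  have hx : φ (unop (ρ (xRow q u r))) (g 1) = ∑ w, g w := by
    rw [xRow, map_sum, Finset.unop_sum, map_sum, LinearMap.sum_apply]
    exact Finset.sum_congr rfl fun w _ ↦ hTw w
  have h1 : φ (unop (ρ (xRow q u r * ev q u f))) (g 1) =
      ∑ w, Finsupp.single w (1 : R) ⊗ₜ (⟨f, hf⟩ : trunc R r m) := by
    rw [map_mul, unop_mul, map_mul, Module.End.mul_apply, hx, unop_antiHom_ev hρL, map_sum]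
    exact Finset.sum_congr rfl fun w _ ↦ truncRep_ev hm hpq regT_regT hφL _ ⟨f, hf⟩
  rw [h, map_zero, unop_zero, map_zero, LinearMap.zero_apply] at h1
  -- By `h1` the vector is the sum over `w` of `w ⊗ f`; its component at `w = 1` is `f`.
  have h2 := congrArg (fun n ↦ TensorProduct.lid R _
    (LinearMap.rTensor _ (Finsupp.lapply (1 : Equiv.Perm (Fin r))) n)) h1
  simp only [map_zero, map_sum, LinearMap.rTensor_tmul, Finsupp.lapply_apply,
    TensorProduct.lid_tmul, Finsupp.single_apply, ite_smul, one_smul, zero_smul,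
    Finset.sum_ite_eq', Finset.mem_univ, if_true] at h2
  exact (congrArg Subtype.val h2).symm

end Independence

/-! ### Symmetric polynomials with bounded exponents -/

section Symmetric

open MvPolynomial

variable {R : Type*} [CommRing R] {m r : ℕ}

theorem isSymmetric_of_polySwap {f : Poly R r} (hf : ∀ i, polySwap i f = f) : f.IsSymmetric := by
  intro w
  obtain ⟨l, rfl⟩ := exists_word w
  induction l with
  | nil => simp
  | cons i l ih =>
    rw [List.map_cons, List.prod_cons, Equiv.Perm.coe_mul, ← rename_rename, ih]
    exact hf i

theorem polySwap_of_isSymmetric {f : Poly R r} (hf : f.IsSymmetric) (i : Fin (r - 1)) :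
    polySwap i f = f := hf _

variable (R) in
/-- The product of powers of elementary symmetric polynomials. -/
noncomputable def esymmPow (a : Fin r → ℕ) : Poly R r :=
  ∏ i : Fin r, esymm (Fin r) R (i + 1) ^ a i

theorem esymmAlgHom_monomial (s : Fin r →₀ ℕ) :
    (esymmAlgHom (Fin r) R r (monomial s 1) : Poly R r) = esymmPow R s := by
  rw [esymmAlgHom_apply, aeval_monomial, map_one, one_mul, Finsupp.prod_fintype _ _ (by simp)]
  rfl

theorem esymmPow_isSymmetric (a : Fin r → ℕ) : (esymmPow R a).IsSymmetric := by
  have := esymmAlgHom_monomial (R := R) (Finsupp.equivFunOnFinite.symm a)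
  rw [Finsupp.coe_equivFunOnFinite_symm] at this
  rw [← this]
  exact (esymmAlgHom (Fin r) R r _).2

theorem degreeOf_esymm_le (k : ℕ) (j : Fin r) : degreeOf j (esymm (Fin r) R k) ≤ 1 := by
  rw [esymm_eq_sum_monomial]
  refine (degreeOf_sum_le _ _ _).trans (Finset.sup_le fun S _ ↦ ?_)
  refine (degreeOf_le_iff).mpr fun s hs ↦ ?_
  rw [Finset.mem_singleton.mp (support_monomial_subset hs), Finsupp.finsetSum_apply]
  simp only [Finsupp.single_apply, Finset.sum_ite_eq']
  split_ifs <;> omega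

/-- Elementary symmetric polynomials have degree at most one in each variable, so the sum of the `a
i` bounds every exponent. -/
theorem esymmPow_mem_trunc {a : Fin r → ℕ} (ha : ∑ i, a i < m) : esymmPow R a ∈ trunc R r m := by
  refine mem_box.mpr fun s hs j ↦ lt_of_le_of_lt ?_ ha
  refine (degreeOf_le_iff.mp le_rfl s hs).trans ?_
  refine (degreeOf_prod_le _ _ _).trans (Finset.sum_le_sum fun i _ ↦ ?_)
  refine (degreeOf_pow_le _ _ _).trans ?_
  simpa using Nat.mul_le_mul_left (a i) (degreeOf_esymm_le (R := R) (i + 1) j)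

/-- If a symmetric polynomial has exponents less than `m`, then its expression in elementary
symmetric polynomials has degree less than `m`. -/
theorem sum_lt_of_esymmAlgHom_mem_trunc (hm : 1 ≤ m) {p : MvPolynomial (Fin r) R}
    (hp : (esymmAlgHom (Fin r) R r p : Poly R r) ∈ trunc R r m) {s : Fin r →₀ ℕ}
    (hs : s ∈ p.support) : ∑ i, s i < m := by
  obtain _ | r := r
  · simpa using Nat.pos_of_ne_zero (Nat.one_le_iff_ne_zero.mp hm)
  -- The leading exponent of `X_i` in a product of elementary symmetric polynomials is a tail sum of
  -- the exponents; at index `0` it is the whole sum.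
  have hacc : ∀ s : Fin (r + 1) →₀ ℕ, Fin.accumulate (r + 1) (r + 1) s 0 = ∑ i, s i := by
    intro s; simp [Fin.accumulate_apply]
  let D : (Fin (r + 1) →₀ ℕ) → Lex (Fin (r + 1) →₀ ℕ) := fun s ↦
    toLex (Finsupp.equivFunOnFinite.symm (Fin.accumulate (r + 1) (r + 1) s))
  have hD : ∀ s ∈ p.support, AddMonoidAlgebra.supDegree toLex
      (esymmAlgHomMonomial (Fin (r + 1)) s (coeff s p)) = D s := by
    intro s hs
    rw [← ofLex_inj, DFunLike.ext'_iff,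
      supDegree_esymmAlgHomMonomial (mem_support_iff.mp hs) s le_rfl]
    rfl
  have hDinj : Function.Injective D := by
    intro s s' h
    have h1 := congrArg (fun x ↦ Finsupp.equivFunOnFinite (ofLex x)) h
    simp only [D, ofLex_toLex, Equiv.apply_symm_apply] at h1
    exact DFunLike.ext' (Fin.accumulate_injective le_rfl h1)
  obtain ⟨t, ht, hmax⟩ := p.support.exists_max_image D ⟨s, hs⟩
  have hsum : (esymmAlgHom (Fin (r + 1)) R (r + 1) p : Poly R (r + 1)) =
      ∑ s ∈ p.support, esymmAlgHomMonomial (Fin (r + 1)) s (coeff s p) := by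
    conv_lhs => rw [p.as_sum]
    rw [map_sum, AddSubmonoidClass.coe_finsetSum]
    rfl
  -- Different exponent vectors have different leading monomials, so the largest one cannot cancel
  -- and really occurs in the symmetric polynomial.
  have hlead := AddMonoidAlgebra.supDegree_leadingCoeff_sum_eq (D := toLex) (s := p.support)
    (f := fun s ↦ esymmAlgHomMonomial (Fin (r + 1)) s (coeff s p)) ht (fun s hs hne ↦ by
      rw [hD s hs, hD t ht]
      exact lt_of_le_of_ne (hmax s hs) (hDinj.ne hne))
  rw [← hsum, hD t ht, leadingCoeff_esymmAlgHomMonomial t le_rfl] at hlead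
  have hcoeff : coeff (ofLex (D t)) (esymmAlgHom (Fin (r + 1)) R (r + 1) p : Poly R (r + 1)) ≠ 0 := by
    have h1 := hlead.2
    rw [leadingCoeff_toLex, hlead.1] at h1
    rw [h1]
    exact mem_support_iff.mp ht
  have ht0 := mem_box.mp hp _ (mem_support_iff.mpr hcoeff) 0
  have ht1 : ofLex (D t) 0 = ∑ i, t i := hacc t
  have hs1 : ofLex (D s) 0 = ∑ i, s i := hacc s
  -- The lexicographic order compares index `0` first, so the maximal `t` also has the largest
  -- exponent sum.
  have hle : ofLex (D s) 0 ≤ ofLex (D t) 0 := by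
    rcases (hmax s hs).eq_or_lt with h | h
    · rw [h]
    · obtain ⟨i, hi1, hi2⟩ := h
      by_cases hi0 : i = 0
      · subst hi0; exact hi2.le
      · exact (hi1 0 (Fin.pos_iff_ne_zero.mpr hi0)).le
  omega

end Symmetric

/-! ### The module `x_(r) H` and its endomorphisms -/

section RowModule

open MvPolynomial

variable {R : Type*} [CommRing R] {q : R} {m : ℕ} {u : Fin m → R} {r : ℕ}

theorem mem_rightIdeal {x y : Hecke q u r} : y ∈ rightIdeal x ↔ ∃ h, y = x * h := by
  rw [rightIdeal, Submodule.mem_span_singleton]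
  exact ⟨fun ⟨a, ha⟩ ↦ ⟨a.unop, ha.symm⟩, fun ⟨h, hh⟩ ↦ ⟨MulOpposite.op h, hh.symm⟩⟩

theorem mem_leftIdeal {x y : Hecke q u r} : y ∈ leftIdeal x ↔ ∃ h, y = h * x := by
  rw [leftIdeal, Submodule.mem_span_singleton]
  exact ⟨fun ⟨a, ha⟩ ↦ ⟨a, ha.symm⟩, fun ⟨h, hh⟩ ↦ ⟨h, hh.symm⟩⟩

/-- The elements of `x_(r) H` on which every `T_i` acts as `q` are given by symmetric polynomials
in the Jucys--Murphy elements. -/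
theorem exists_eq_xRow_mul_ev (hq : IsUnit q) (hm : 1 ≤ m) {y : Hecke q u r}
    (hy : y ∈ rightIdeal (xRow q u r)) (hT : ∀ i, y * T q u i = q • y) :
    ∃ f : Poly R r, f ∈ trunc R r m ∧ f.IsSymmetric ∧ y = xRow q u r * ev q u f := by
  obtain ⟨h, rfl⟩ := mem_rightIdeal.mp hy
  obtain ⟨f, hf, e⟩ := exists_trunc_of_xRow_mul hq hm h
  rw [e] at hT ⊢
  refine ⟨f, hf, isSymmetric_of_polySwap fun i ↦ ?_, rfl⟩
  -- Uniqueness of the truncated polynomial transfers the eigenvector equation from `H` to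
  -- polynomials.
  refine polySwap_eq_of_eigen (q := q) (sub_eq_zero.mp (eq_zero_of_xRow_mul_ev (u := u) hq hm ?_ ?_))
  · exact Submodule.sub_mem _ (Submodule.add_mem _ (Submodule.smul_mem _ _ (polySwap_mem_trunc hf i))
      (Submodule.smul_mem _ _ (dem_mem_trunc hf i))) (Submodule.smul_mem _ _ hf)
  · rw [map_sub, mul_sub, ← xRow_mul_ev_mul_T hq, hT, map_smul, mul_smul_comm, sub_self]

theorem mul_T_of_mem_leftIdeal {y : Hecke q u r} (hy : y ∈ leftIdeal (xRow q u r))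
    (i : Fin (r - 1)) : y * T q u i = q • y := by
  obtain ⟨h, rfl⟩ := mem_leftIdeal.mp hy
  rw [mul_assoc, xRow_mul_T, mul_smul_comm]

theorem sigmaPow_eq_ev_esymmPow (a : Fin r → ℕ) : sigmaPow q u a = ev q u (esymmPow R a) :=
  sigmaPow_eq_ev a

theorem xRow_mul_sigmaPow (hq : IsUnit q) (a : Fin r → ℕ) :
    xRow q u r * sigmaPow q u a = sigmaPow q u a * xRow q u r := by
  rw [sigmaPow_eq_ev_esymmPow,
    ev_mul_xRow hq fun i ↦ polySwap_of_isSymmetric (esymmPow_isSymmetric a) i]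

theorem xRow_mul_sigmaPow_mem (hq : IsUnit q) (a : Fin r → ℕ) :
    xRow q u r * sigmaPow q u a ∈ rowIntersection q u r :=
  ⟨mem_rightIdeal.mpr ⟨_, rfl⟩, mem_leftIdeal.mpr ⟨_, xRow_mul_sigmaPow hq a⟩⟩

/-- The products of elementary symmetric polynomials are independent, and `f ↦ x f(L)` is injective
on their span because this span lies in `trunc`. -/
theorem linearIndependent_xRow_mul_sigmaPow (hq : IsUnit q) (hm : 1 ≤ m) :
    LinearIndependent R fun a : CompLT r m ↦ xRow q u r * sigmaPow q u a.1 := by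
  let E : MvPolynomial (Fin r) R →ₗ[R] Poly R r :=
    (symmetricSubalgebra (Fin r) R).val.toLinearMap ∘ₗ (esymmAlgHom (Fin r) R r).toLinearMap
  have hE : LinearMap.ker E = ⊥ :=
    LinearMap.ker_eq_bot.mpr (Subtype.val_injective.comp (esymmAlgHom_fin_injective R le_rfl))
  have h1 : LinearIndependent R fun a : CompLT r m ↦
      (monomial (Finsupp.equivFunOnFinite.symm a.1) 1 : MvPolynomial (Fin r) R) := by
    have := (basisMonomials (Fin r) R).linearIndependent.comp
      (fun a : CompLT r m ↦ Finsupp.equivFunOnFinite.symm a.1)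
      (Finsupp.equivFunOnFinite.symm.injective.comp Subtype.val_injective)
    simpa [Function.comp_def] using this
  have h2 : LinearIndependent R fun a : CompLT r m ↦ esymmPow R a.1 := by
    have hfun : (fun a : CompLT r m ↦ esymmPow R a.1) =
        E ∘ fun a ↦ monomial (Finsupp.equivFunOnFinite.symm a.1) 1 := funext fun a ↦
      ((esymmAlgHom_monomial _).trans (by rw [Finsupp.coe_equivFunOnFinite_symm])).symm
    rw [hfun]
    exact h1.map' E hE
  have h3 := h2.map (f := LinearMap.mulLeft R (xRow q u r) ∘ₗ (ev q u).toLinearMap) (by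
    rw [Submodule.disjoint_def]
    intro f hf hf'
    have hft : f ∈ trunc R r m := by
      refine Submodule.span_le.mpr ?_ hf
      rintro _ ⟨a, rfl⟩
      exact esymmPow_mem_trunc a.2
    exact eq_zero_of_xRow_mul_ev hq hm hft hf')
  simp only [sigmaPow_eq_ev_esymmPow]
  exact h3

/-- An element of the intersection comes from a truncated symmetric `f`; the truncation bounds the
exponent sums in its expression by elementary symmetric polynomials. -/
theorem rowIntersection_le_span (hq : IsUnit q) (hm : 1 ≤ m) :
    rowIntersection q u r ≤
      Submodule.span R (Set.range fun a : CompLT r m ↦ xRow q u r * sigmaPow q u a.1) := by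
  rintro y ⟨hy1, hy2⟩
  obtain ⟨f, hf, hsym, rfl⟩ :=
    exists_eq_xRow_mul_ev hq hm hy1 fun i ↦ mul_T_of_mem_leftIdeal hy2 i
  obtain ⟨p, hp⟩ := esymmAlgHom_fin_surjective R le_rfl (⟨f, hsym⟩ : symmetricSubalgebra (Fin r) R)
  have hpf : (esymmAlgHom (Fin r) R r p : Poly R r) = f := congrArg Subtype.val hp
  have hsum : f = ∑ s ∈ p.support, coeff s p • esymmPow R s := by
    rw [← hpf]
    conv_lhs => rw [p.as_sum]
    rw [map_sum, AddSubmonoidClass.coe_finsetSum]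
    refine Finset.sum_congr rfl fun s _ ↦ ?_
    rw [← esymmAlgHom_monomial, ← mul_one (coeff s p), ← smul_eq_mul, ← smul_monomial, map_smul,
      smul_eq_mul, mul_one]
    rfl
  rw [hsum, map_sum, Finset.mul_sum]
  refine Submodule.sum_mem _ fun s hs ↦ ?_
  rw [map_smul, mul_smul_comm]
  refine Submodule.smul_mem _ _ (Submodule.subset_span ⟨⟨s, ?_⟩, ?_⟩)
  · exact sum_lt_of_esymmAlgHom_mem_trunc hm (hpf ▸ hf) hs
  · simp only [sigmaPow_eq_ev_esymmPow]

/-- The basis of `x_(r) H ∩ H x_(r)`. -/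
theorem exists_basis_rowIntersection (hq : IsUnit q) (hm : 1 ≤ m) :
    ∃ b : Module.Basis (CompLT r m) R (rowIntersection q u r),
      ∀ a, (b a : Hecke q u r) = xRow q u r * sigmaPow q u a.1 := by
  let v : CompLT r m → rowIntersection q u r := fun a ↦ ⟨_, xRow_mul_sigmaPow_mem hq a.1⟩
  have hli : LinearIndependent R v :=
    LinearIndependent.of_comp (rowIntersection q u r).subtype
      (linearIndependent_xRow_mul_sigmaPow hq hm)
  have hspan : ⊤ ≤ Submodule.span R (Set.range v) := by
    rw [← Submodule.map_le_map_iff_of_injective (rowIntersection q u r).injective_subtype,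
      Submodule.map_subtype_top, Submodule.map_span, ← Set.range_comp]
    exact rowIntersection_le_span hq hm
  exact ⟨Module.Basis.mk hli hspan, fun a ↦ by rw [Module.Basis.mk_apply]⟩

/-- Endomorphisms of `x_(r) H` are left multiplications by symmetric polynomials in the
Jucys--Murphy elements. -/
theorem exists_ev_mul (hq : IsUnit q) (hm : 1 ≤ m)
    (φ : Module.End (Hecke q u r)ᵐᵒᵖ (rightIdeal (xRow q u r))) :
    ∃ f : Poly R r, ∀ z, (φ z : Hecke q u r) = ev q u f * z.1 := by
  let x : rightIdeal (xRow q u r) := ⟨xRow q u r, mem_rightIdeal.mpr ⟨1, (mul_one _).symm⟩⟩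
  have hφ : ∀ z h, (φ z : Hecke q u r) * h = φ (MulOpposite.op h • z) := fun z h ↦ by
    rw [map_smul]; rfl
  obtain ⟨f, -, hsym, hf⟩ := exists_eq_xRow_mul_ev hq hm (φ x).2 fun i ↦ by
    -- `φ` is linear over `H` only, so the scalar `q` is written as right multiplication by its
    -- image in `H`; then `φ(x) T_i = φ(x T_i) = q φ(x)`.
    have h1 : MulOpposite.op (T q u i) • x = MulOpposite.op (algebraMap R (Hecke q u r) q) • x := by
      refine Subtype.ext ?_
      change xRow q u r * T q u i = xRow q u r * algebraMap R _ q
      rw [xRow_mul_T, ← Algebra.commutes, Algebra.smul_def]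
    rw [hφ, h1, ← hφ, ← Algebra.commutes, Algebra.smul_def]
  refine ⟨f, fun z ↦ ?_⟩
  obtain ⟨h, hh⟩ := mem_rightIdeal.mp z.2
  have hz : z = MulOpposite.op h • x := Subtype.ext hh
  rw [hh, hz, ← hφ, hf, ← ev_mul_xRow hq fun i ↦ polySwap_of_isSymmetric hsym i, mul_assoc]

theorem end_xRow_comm (hq : IsUnit q) (hm : 1 ≤ m)
    (φ ψ : Module.End (Hecke q u r)ᵐᵒᵖ (rightIdeal (xRow q u r))) : φ * ψ = ψ * φ := by
  obtain ⟨f, hf⟩ := exists_ev_mul hq hm φ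
  obtain ⟨g, hg⟩ := exists_ev_mul hq hm ψ
  refine LinearMap.ext fun z ↦ Subtype.ext ?_
  rw [Module.End.mul_apply, Module.End.mul_apply, hf, hg, hg, hf, ← mul_assoc, ← mul_assoc,
    ev_mul_comm]

end RowModule

/-! ### Endomorphism algebras of direct sums and their corners -/

section Corner

variable {R : Type*} [CommRing R] (q : R) {m : ℕ} (u : Fin m → R) {r : ℕ}

theorem inBlock_row (n : ℕ) [NeZero n] (k : Fin n) (i : Fin r) :
    InBlock (Comp.row n r) k i ↔ k = 0 := by
  rw [InBlock, Comp.row]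
  by_cases hk : k = 0
  · subst hk
    have h1 : ∑ j ∈ Finset.Iio (0 : Fin n), (Pi.single 0 r : Fin n → ℕ) j = 0 :=
      Finset.sum_eq_zero fun j hj ↦ absurd (Finset.mem_Iio.mp hj) (Fin.not_lt_zero j)
    have h2 : ∑ j ∈ Finset.Iic (0 : Fin n), (Pi.single 0 r : Fin n → ℕ) j = r := by
      rw [Finset.sum_pi_single', if_pos (Finset.mem_Iic.mpr le_rfl)]
    simp [h1, h2]
  · have h1 : ∑ j ∈ Finset.Iio k, (Pi.single 0 r : Fin n → ℕ) j = r := by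
      rw [Finset.sum_pi_single', if_pos (Finset.mem_Iio.mpr (Fin.pos_iff_ne_zero.mpr hk))]
    simp only [h1, hk, iff_false]
    have := i.2
    omega

theorem xComp_row (n : ℕ) [NeZero n] : xComp q u (Comp.row n r) = xRow q u r := by
  classical
  rw [xComp, xRow]
  refine Finset.sum_congr ?_ fun _ _ ↦ rfl
  refine Finset.filter_true_of_mem fun w _ k i ↦ ?_
  rw [inBlock_row, inBlock_row]

theorem nonempty_end_equiv_of_eq {x y : Hecke q u r} (h : x = y) :
    Nonempty (Module.End (Hecke q u r)ᵐᵒᵖ (rightIdeal x) ≃ₐ[R]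
      Module.End (Hecke q u r)ᵐᵒᵖ (rightIdeal y)) := by
  subst h
  exact ⟨AlgEquiv.refl⟩

/-- The corner cut out by the projection to a summand is the endomorphism algebra of the
summand. -/
noncomputable def centraliserEquiv {n : ℕ} (mu : Comp n r) : Centraliser q u mu ≃ₐ[R]
    Module.End (Hecke q u r)ᵐᵒᵖ (rightIdeal (xComp q u mu)) := by
  let H := (Hecke q u r)ᵐᵒᵖ
  let ι := DirectSum.lof H (Comp n r) (fun lam ↦ rightIdeal (xComp q u lam)) mu
  let π := DirectSum.component H (Comp n r) (fun lam ↦ rightIdeal (xComp q u lam)) mu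
  have hπι : ∀ z, π (ι z) = z := fun z ↦ by
    simp [π, ι, DirectSum.component.lof_self]
  have hmem : ∀ f : Centraliser q u mu, idem q u mu * f.1 = f.1 ∧ f.1 * idem q u mu = f.1 :=
    fun f ↦ (Subsemigroup.mem_corner_iff (idem_isIdempotentElem q u mu)).mp f.2
  exact
    { toFun := fun f ↦ π ∘ₗ f.1 ∘ₗ ι
      invFun := fun g ↦ ⟨ι ∘ₗ g ∘ₗ π, (Subsemigroup.mem_corner_iff
        (idem_isIdempotentElem q u mu)).mpr
          ⟨LinearMap.ext fun z ↦ congrArg ι (hπι _),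
            LinearMap.ext fun z ↦ congrArg (fun y ↦ ι (g y)) (hπι _)⟩⟩
      -- With `e = ι π`, the round trip sends `f` to `e f e`, which is `f` for an element of the
      -- corner.
      left_inv := fun f ↦ Subtype.ext <| LinearMap.ext fun z ↦ by
        have h1 := congrArg (fun φ ↦ φ z) (hmem f).2
        have h2 := congrArg (fun φ ↦ φ (ι (π z))) (hmem f).1
        exact h2.trans h1
      right_inv := fun g ↦ LinearMap.ext fun z ↦ by
        change π (ι (g (π (ι z)))) = g z
        rw [hπι, hπι]
      map_mul' := fun f g ↦ LinearMap.ext fun z ↦ by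
        change π (f.1 (g.1 (ι z))) = π (f.1 (ι (π (g.1 (ι z)))))
        exact congrArg π (congrArg (fun φ ↦ φ (g.1 (ι z))) (hmem f).2).symm
      map_add' := fun f g ↦ LinearMap.ext fun z ↦ map_add π (f.1 (ι z)) (g.1 (ι z))
      commutes' := fun c ↦ LinearMap.ext fun z ↦ by
        change π (c • ι (π (ι z))) = c • z
        rw [hπι]
        exact congrArg (c • ·) (hπι z) }

theorem comp_one_eq_row (lam : Comp 1 r) : lam = Comp.row 1 r := by
  refine Subtype.ext (funext fun i ↦ ?_)
  have h1 := lam.2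
  rw [Fin.sum_univ_one] at h1
  rw [Subsingleton.elim i 0, h1]
  simp [Comp.row]

/-- There is only one composition of `r` into one part, so the projection is the identity and the
corner is all of `S_m(1, r)`. -/
theorem idem_row_one : idem q u (Comp.row 1 r) = 1 := by
  ext1 lam
  obtain rfl := comp_one_eq_row lam
  ext1 z
  simp [idem, DirectSum.component.lof_self]

/-- The corner of the unit element is the whole algebra. -/
theorem nonempty_corner_equiv_of_eq_one {A : Type*} [Semiring A] [Algebra R A] {e : A}
    (he : IsIdempotentElem e) (h : e = 1) : Nonempty (he.Corner ≃ₐ[R] A) := by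
  subst h
  refine ⟨AlgEquiv.ofBijective
    { toFun := fun x ↦ x.1
      map_one' := rfl
      map_mul' := fun _ _ ↦ rfl
      map_zero' := rfl
      map_add' := fun _ _ ↦ rfl
      commutes' := fun c ↦ (Algebra.algebraMap_eq_smul_one c).symm } ⟨Subtype.val_injective, fun x ↦
    ⟨⟨x, (Subsemigroup.mem_corner_iff he).mpr ⟨one_mul x, mul_one x⟩⟩, rfl⟩⟩⟩

theorem nonempty_centraliser_equiv (n : ℕ) [NeZero n] :
    Nonempty (Centraliser q u (Comp.row n r) ≃ₐ[R]
      Module.End (Hecke q u r)ᵐᵒᵖ (rightIdeal (xRow q u r))) := by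
  obtain ⟨e⟩ := nonempty_end_equiv_of_eq q u (xComp_row q u n (r := r))
  exact ⟨(centraliserEquiv q u _).trans e⟩

theorem nonempty_centraliser_one_equiv :
    Nonempty (Centraliser q u (Comp.row 1 r) ≃ₐ[R] Schur q u 1 r) :=
  nonempty_corner_equiv_of_eq_one (R := R) (A := Schur q u 1 r) (e := idem q u (Comp.row 1 r))
    (idem_isIdempotentElem q u (Comp.row 1 r)) (idem_row_one q u)

theorem nonempty_schur_one_equiv : Nonempty (Schur q u 1 r ≃ₐ[R]
    Module.End (Hecke q u r)ᵐᵒᵖ (rightIdeal (xRow q u r))) := by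
  obtain ⟨e⟩ := nonempty_centraliser_equiv q u 1 (r := r)
  obtain ⟨e'⟩ := nonempty_centraliser_one_equiv q u (r := r)
  exact ⟨e'.symm.trans e⟩

theorem comm_of_algEquiv {A B : Type*} [Semiring A] [Semiring B] [Algebra R A] [Algebra R B]
    (e : A ≃ₐ[R] B) (h : ∀ x y : B, x * y = y * x) (x y : A) : x * y = y * x :=
  e.injective (by rw [map_mul, map_mul, h])

end Corner

end SlimSchur

/-! ### Assembly: all the algebras are compared with the commutative algebra `End_H (x_(r) H)`. -/

theorem mainTheorem4 {R : Type*} [CommRing R] (q : R) (hq : IsUnit q)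
    (m : ℕ) (hm : 1 ≤ m) (u : Fin m → R) (r : ℕ) :
    -- the elements `x_(r) σ^a = σ^a x_(r)` form a basis of `x_(r) H ∩ H x_(r)`
    (∀ a : Fin r → ℕ, ∑ i, a i < m →
      SlimSchur.xRow q u r * SlimSchur.sigmaPow q u a =
        SlimSchur.sigmaPow q u a * SlimSchur.xRow q u r) ∧
    (∃ b : Module.Basis (SlimSchur.CompLT r m) R (SlimSchur.rowIntersection q u r),
      ∀ a : SlimSchur.CompLT r m,
        (b a : SlimSchur.Hecke q u r) =
          SlimSchur.xRow q u r * SlimSchur.sigmaPow q u a.1) ∧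
    -- `End_H (x_(r) H)` is commutative
    (∀ f g : Module.End (SlimSchur.Hecke q u r)ᵐᵒᵖ
        (SlimSchur.rightIdeal (SlimSchur.xRow q u r)), f * g = g * f) ∧
    -- `S_m(1, r)` is commutative, and it is `End_H (x_(r) H)`
    (∀ f g : SlimSchur.Schur q u 1 r, f * g = g * f) ∧
    Nonempty (SlimSchur.Schur q u 1 r ≃ₐ[R]
      Module.End (SlimSchur.Hecke q u r)ᵐᵒᵖ (SlimSchur.rightIdeal (SlimSchur.xRow q u r))) ∧
    -- for `n ≥ 1`, the algebra `l_(r) S_m(n, r) l_(r)` is commutative, and it is `S_m(1, r)`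
    (∀ (n : ℕ) [NeZero n],
      (∀ f g : SlimSchur.Centraliser q u (SlimSchur.Comp.row n r), f * g = g * f) ∧
      Nonempty (SlimSchur.Centraliser q u (SlimSchur.Comp.row n r) ≃ₐ[R]
        SlimSchur.Schur q u 1 r)) := by
  obtain ⟨e⟩ := SlimSchur.nonempty_schur_one_equiv q u (r := r)
  have hcomm := SlimSchur.end_xRow_comm (q := q) (u := u) (r := r) hq hm
  refine ⟨fun a _ ↦ SlimSchur.xRow_mul_sigmaPow hq a, SlimSchur.exists_basis_rowIntersection hq hm,
    hcomm, SlimSchur.comm_of_algEquiv e hcomm, ⟨e⟩, fun n _ ↦ ?_⟩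
  obtain ⟨e'⟩ := SlimSchur.nonempty_centraliser_equiv q u n (r := r)
  exact ⟨SlimSchur.comm_of_algEquiv e' hcomm, ⟨e'.trans e.symm⟩⟩
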